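/- Let $p,q\ge 0$ with $p+q>0$. Let $C[-\infty,+\infty]$ be the Banach space of real continuous functions on $\mathbb R$ that have finite limits at $+\infty$ and at $-\infty$, with the supremum norm. For $t\ge 0$ and $f\in C[-\infty,+\infty]$ put $$ C^*_{p,q}(t)f(x)=\begin{cases} \tfrac12\,[f(x+t)+f(x-t)], & |x|\ge t,\\[2pt] \tfrac12\,[f(x+t)+f(x-t)]+\dfrac{q-p}{2(p+q)}\,[f(-x-t)-f(x+t)], & -t<x\le 0,\\[4pt] \tfrac12\,[f(x+t)+f(x-t)]+\dfrac{p-q}{2(p+q)}\,[f(t-x)-f(x-t)], & 0<x<t, \end{cases} $$ and $C^*_{p,q}(-t):=C^*_{p,q}(t)$. Let $\Delta^*_{p,q}$ be the operator in $C[-\infty,+\infty]$ given by $\Delta^*_{p,q}f=f''$, whose domain consists of the $f\in C[-\infty,+\infty]$ such that (a) $f$ is twice continuously differentiable on $(-\infty,0]$ and on $[0,\infty)$, separately, with one-sided derivatives at $0$; (b) the limits $\lim_{x\to\infty}f''(x)$ and $\lim_{x\to-\infty}f''(x)$ exist and are finite; (c) $p f'(0+)=q f'(0-)$ and $f''(0+)=f''(0-)$.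 Then $\{C^*_{p,q}(t),\,t\in\mathbb R\}$ is a strongly continuous cosine family of bounded linear operators on $C[-\infty,+\infty]$: $C^*_{p,q}(0)=I$, $2C^*_{p,q}(t)C^*_{p,q}(s)=C^*_{p,q}(t+s)+C^*_{p,q}(t-s)$ for all $s,t\in\mathbb R$, and $t\mapsto C^*_{p,q}(t)f$ is continuous for every $f$. Its generator is $\Delta^*_{p,q}$; that is, $f\in \mathrm{dom}\,\Delta^*_{p,q}$ and $\Delta^*_{p,q}f=g$ if and only if $\lim_{t\to0}2t^{-2}(C^*_{p,q}(t)f-f)=g$ in norm, and, equivalently, for every $\lambda>0$ the resolvent $(\lambda^2-\Delta^*_{p,q})^{-1}$ exists as a bounded operator and $$\lambda(\lambda^2-\Delta^*_{p,q})^{-1}g=\int_0^\infty e^{-\lambda t}\,C^*_{p,q}(t)g\,dt,\qquad g\in C[-\infty,+\infty].$$ Moreover, $$\|C^*_{p,q}(t)\|\le \frac{2\max(p,q)}{p+q},\qquad t\in\mathbb R.$$ -/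

import Mathlib

open scoped Topology BoundedContinuousFunction

noncomputable section

namespace SkewCosine

/-! ### Cosine families on a Banach space and their generators -/

section Abstract

variable {E : Type*} [NormedAddCommGroup E] [NormedSpace ℝ E]

/-- A strongly continuous cosine family of bounded linear operators. -/
structure IsStronglyContinuousCosineFamily (C : ℝ → E →L[ℝ] E) : Prop where
  zero : C 0 = ContinuousLinearMap.id ℝ E
  dAlembert : ∀ t s : ℝ, (2 : ℝ) • (C t ∘L C s) = C (t + s) + C (t - s)
  strong_continuity : ∀ f : E, Continuous fun t : ℝ => C t f

/-- `A` is the infinitesimal generator of `C`, that is `A = C''(0)`: a vector `f` is in the domain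
of `A` and `A f = g` exactly when `2 t⁻² (C(t) f - f)` converges to `g` in norm as `t → 0`. -/
def IsInfinitesimalGenerator (C : ℝ → E →L[ℝ] E) (A : E →ₗ.[ℝ] E) : Prop :=
  ∀ f g : E, (∃ hf : f ∈ A.domain, A ⟨f, hf⟩ = g) ↔
    Filter.Tendsto (fun t : ℝ => (2 / t ^ 2) • (C t f - f)) (𝓝[≠] 0) (𝓝 g)

/-- `R` is the resolvent `(μ - A)⁻¹`: a bounded, everywhere defined, two-sided inverse of
`μ - A : dom A → E`. -/
structure IsResolventAt (A : E →ₗ.[ℝ] E) (μ : ℝ) (R : E →L[ℝ] E) : Prop where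
  mem_domain : ∀ g : E, R g ∈ A.domain
  right_inverse : ∀ g : E, μ • R g - A ⟨R g, mem_domain g⟩ = g
  left_inverse : ∀ f : A.domain, R (μ • (f : E) - A f) = f

/-- `A` is the generator of the bounded family `C` in the sense of Laplace transforms: for every
`l > 0`, `l (l² - A)⁻¹ g = ∫₀^∞ e^{-l t} C(t) g dt` for all `g`, where the resolvent exists and
the Bochner integral converges absolutely. -/
def IsLaplaceGenerator (C : ℝ → E →L[ℝ] E) (A : E →ₗ.[ℝ] E) : Prop :=
  ∀ l : ℝ, 0 < l → ∃ R : E →L[ℝ] E, IsResolventAt A (l ^ 2) R ∧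
    ∀ g : E,
      MeasureTheory.IntegrableOn (fun t : ℝ => Real.exp (-l * t) • C t g) (Set.Ioi 0) ∧
      l • R g = ∫ t in Set.Ioi (0 : ℝ), Real.exp (-l * t) • C t g

end Abstract

/-! ### The space `C[-∞, +∞]` -/

/-- `f` has finite limits at `+∞` and at `-∞`. -/
def HasFiniteLimits (f : ℝ → ℝ) : Prop :=
  (∃ a : ℝ, Filter.Tendsto f Filter.atTop (𝓝 a)) ∧
    ∃ b : ℝ, Filter.Tendsto f Filter.atBot (𝓝 b)

/-- The continuous functions on `ℝ` with finite limits at `±∞` (they are automatically bounded),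
as a subspace of the bounded continuous functions with the supremum norm. -/
def cLim : Submodule ℝ (ℝ →ᵇ ℝ) where
  carrier := {f | HasFiniteLimits f}
  add_mem' := by
    rintro f g ⟨⟨a, ha⟩, b, hb⟩ ⟨⟨a', ha'⟩, b', hb'⟩
    exact ⟨⟨a + a', ha.add ha'⟩, b + b', hb.add hb'⟩
  zero_mem' := ⟨⟨0, tendsto_const_nhds⟩, 0, tendsto_const_nhds⟩
  smul_mem' := by
    rintro c f ⟨⟨a, ha⟩, b, hb⟩
    exact ⟨⟨c * a, ha.const_mul c⟩, c * b, hb.const_mul c⟩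

/-- The Banach space `C[-∞, +∞]` with the supremum norm. -/
def CLim : Type := ↥cLim

instance : NormedAddCommGroup CLim := inferInstanceAs (NormedAddCommGroup ↥cLim)

instance : NormedSpace ℝ CLim := inferInstanceAs (NormedSpace ℝ ↥cLim)

theorem CLim.norm_eq (f : CLim) : ‖f‖ = ‖f.1‖ := rfl

theorem exists_limit_of_mem_closure {l : Filter ℝ} [l.NeBot] {S : Set (ℝ →ᵇ ℝ)}
    (hS : ∀ g ∈ S, ∃ a : ℝ, Filter.Tendsto g l (𝓝 a)) {f : ℝ →ᵇ ℝ} (hf : f ∈ closure S) :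
    ∃ a : ℝ, Filter.Tendsto f l (𝓝 a) := by
  rw [← cauchy_map_iff_exists_tendsto, Metric.cauchy_iff]
  refine ⟨inferInstance, fun ε hε => ?_⟩
  obtain ⟨g, hg, hfg⟩ := Metric.mem_closure_iff.1 hf (ε / 4) (by positivity)
  obtain ⟨a, ha⟩ := hS g hg
  refine ⟨_, Filter.image_mem_map (ha (Metric.ball_mem_nhds a (by positivity : 0 < ε / 4))), ?_⟩
  rintro _ ⟨x, hx, rfl⟩ _ ⟨y, hy, rfl⟩
  have h1 := (f.dist_coe_le_dist (g := g) x).trans_lt hfg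
  have h2 := (f.dist_coe_le_dist (g := g) y).trans_lt hfg
  have h3 : dist (g x) a < ε / 4 := hx
  have h4 : dist (g y) a < ε / 4 := hy
  rw [Real.dist_eq, abs_lt] at *
  constructor <;> linarith [h1.1, h1.2, h2.1, h2.2, h3.1, h3.2, h4.1, h4.2]

/-- `C[-∞, +∞]` is complete. -/
instance : CompleteSpace CLim := by
  have h : IsClosed (cLim : Set (ℝ →ᵇ ℝ)) := isClosed_of_closure_subset fun f hf =>
    ⟨exists_limit_of_mem_closure (fun _ hg => hg.1) hf,
      exists_limit_of_mem_closure (fun _ hg => hg.2) hf⟩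
  exact h.completeSpace_coe

theorem bounded_of_hasFiniteLimits {f : ℝ → ℝ} (hc : Continuous f) (h : HasFiniteLimits f) :
    ∃ M : ℝ, ∀ x, ‖f x‖ ≤ M := by
  obtain ⟨⟨a, ha⟩, b, hb⟩ := h
  obtain ⟨A, hA⟩ := Filter.eventually_atTop.1 (ha.norm.eventually (gt_mem_nhds (lt_add_one ‖a‖)))
  obtain ⟨B, hB⟩ := Filter.eventually_atBot.1 (hb.norm.eventually (gt_mem_nhds (lt_add_one ‖b‖)))
  obtain ⟨K, hK⟩ := (isCompact_Icc (a := B) (b := A)).exists_bound_of_continuousOn hc.continuousOn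
  refine ⟨max K (max (‖a‖ + 1) (‖b‖ + 1)), fun x => ?_⟩
  rcases le_total A x with h1 | h1
  · exact (hA x h1).le.trans ((le_max_left _ _).trans (le_max_right _ _))
  rcases le_total x B with h2 | h2
  · exact (hB x h2).le.trans ((le_max_right _ _).trans (le_max_right _ _))
  · exact (hK x ⟨h2, h1⟩).trans (le_max_left _ _)

/-- A continuous function with finite limits at `±∞`, as an element of `C[-∞, +∞]`. -/
def CLim.mk (f : ℝ → ℝ) (hc : Continuous f) (h : HasFiniteLimits f) : CLim :=
  ⟨BoundedContinuousFunction.ofNormedAddCommGroup f hc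
    (bounded_of_hasFiniteLimits hc h).choose (bounded_of_hasFiniteLimits hc h).choose_spec, h⟩

@[simp] theorem CLim.mk_apply (f : ℝ → ℝ) (hc : Continuous f) (h : HasFiniteLimits f) (x : ℝ) :
    (CLim.mk f hc h).1 x = f x := rfl

theorem CLim.ext {f g : CLim} (h : ∀ x, f.1 x = g.1 x) : f = g :=
  Subtype.ext (BoundedContinuousFunction.ext h)

/-! ### The operators `C*_{p,q}(t)` -/

/-- The explicit formula for `C*_{p,q}(t) f (x)`, for `t ≥ 0`. -/
def cosFormula (p q t : ℝ) (f : ℝ → ℝ) (x : ℝ) : ℝ :=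
  if t ≤ |x| then (f (x + t) + f (x - t)) / 2
  else if x ≤ 0 then
    (f (x + t) + f (x - t)) / 2 + (q - p) / (2 * (p + q)) * (f (-x - t) - f (x + t))
  else
    (f (x + t) + f (x - t)) / 2 + (p - q) / (2 * (p + q)) * (f (t - x) - f (x - t))

theorem continuous_cosFormula (p q : ℝ) {t : ℝ} (ht : 0 ≤ t) {f : ℝ → ℝ} (hf : Continuous f) :
    Continuous (cosFormula p q t f) := by
  unfold cosFormula
  refine Continuous.if_le (by fun_prop) (Continuous.if_le (by fun_prop) (by fun_prop)
    continuous_id continuous_const ?_) continuous_const continuous_abs ?_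
  · rintro x rfl
    simp only [neg_zero, zero_sub, zero_add, sub_zero]
    ring
  · intro x hx
    split_ifs with h
    · have : t = -x := by rw [hx, abs_of_nonpos h]
      subst this
      simp
    · have : t = x := by rw [hx, abs_of_pos (not_le.1 h)]
      subst this
      simp

theorem hasFiniteLimits_cosFormula (p q t : ℝ) {f : ℝ → ℝ} (hf : HasFiniteLimits f) :
    HasFiniteLimits (cosFormula p q t f) := by
  obtain ⟨⟨a, ha⟩, b, hb⟩ := hf
  refine ⟨⟨(a + a) / 2, ?_⟩, (b + b) / 2, ?_⟩
  · have h : Filter.Tendsto (fun x => (f (x + t) + f (x - t)) / 2) Filter.atTop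
        (𝓝 ((a + a) / 2)) :=
      ((ha.comp (Filter.tendsto_atTop_add_const_right _ t Filter.tendsto_id)).add
        (ha.comp (Filter.tendsto_atTop_add_const_right _ (-t) Filter.tendsto_id))).div_const 2
    refine h.congr' ?_
    filter_upwards [Filter.eventually_ge_atTop t] with x hx
    rw [cosFormula, if_pos (hx.trans (le_abs_self x))]
  · have h : Filter.Tendsto (fun x => (f (x + t) + f (x - t)) / 2) Filter.atBot
        (𝓝 ((b + b) / 2)) :=
      ((hb.comp (Filter.tendsto_atBot_add_const_right _ t Filter.tendsto_id)).add
        (hb.comp (Filter.tendsto_atBot_add_const_right _ (-t) Filter.tendsto_id))).div_const 2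
    refine h.congr' ?_
    filter_upwards [Filter.eventually_le_atBot (-t)] with x hx
    rw [cosFormula, if_pos ((le_neg_of_le_neg hx).trans (neg_le_abs x))]

theorem abs_cosFormula_le (p q t : ℝ) {f : ℝ → ℝ} {M : ℝ} (hM : ∀ x, |f x| ≤ M) (x : ℝ) :
    |cosFormula p q t f x| ≤ (1 + 2 * |(q - p) / (2 * (p + q))|) * M := by
  have hM0 : 0 ≤ M := (abs_nonneg _).trans (hM 0)
  have hneg : |(p - q) / (2 * (p + q))| = |(q - p) / (2 * (p + q))| := by
    rw [← abs_neg, ← neg_div, neg_sub]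
  have h1 : |(f (x + t) + f (x - t)) / 2| ≤ M := by
    have := abs_le.1 (hM (x + t)); have := abs_le.1 (hM (x - t))
    rw [abs_le]; constructor <;> linarith
  have h2 : ∀ (c y z : ℝ), |c * (f y - f z)| ≤ 2 * |c| * M := by
    intro c y z
    have : |f y - f z| ≤ 2 * M := by
      have := abs_le.1 (hM y); have := abs_le.1 (hM z)
      rw [abs_le]; constructor <;> linarith
    rw [abs_mul]
    nlinarith [abs_nonneg c]
  unfold cosFormula
  split_ifs
  · nlinarith [mul_nonneg (abs_nonneg ((q - p) / (2 * (p + q)))) hM0]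
  · refine (abs_add_le _ _).trans ((add_le_add h1 (h2 _ _ _)).trans (le_of_eq (by ring)))
  · refine (abs_add_le _ _).trans ((add_le_add h1 (h2 _ _ _)).trans (le_of_eq ?_))
    rw [hneg]; ring

/-- The bounded operator `C*_{p,q}(t)` on `C[-∞, +∞]`, for `t ∈ ℝ`; it is given by the explicit
formula for `t ≥ 0` and extended by `C*_{p,q}(-t) = C*_{p,q}(t)`. -/
def cosStar (p q t : ℝ) : CLim →L[ℝ] CLim :=
  LinearMap.mkContinuous
    { toFun := fun f : CLim => CLim.mk (cosFormula p q |t| f.1)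
        (continuous_cosFormula p q (abs_nonneg t) f.1.continuous)
        (hasFiniteLimits_cosFormula p q |t| f.2)
      map_add' := fun (f g : CLim) => CLim.ext fun (x : ℝ) => by
        change cosFormula p q |t| (fun y => f.1 y + g.1 y) x
          = cosFormula p q |t| f.1 x + cosFormula p q |t| g.1 x
        unfold cosFormula
        split_ifs <;> ring
      map_smul' := fun (c : ℝ) (f : CLim) => CLim.ext fun (x : ℝ) => by
        change cosFormula p q |t| (fun y => c * f.1 y) x = c * cosFormula p q |t| f.1 x
        unfold cosFormula
        split_ifs <;> ring }
    (1 + 2 * |(q - p) / (2 * (p + q))|)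
    (fun f : CLim => (BoundedContinuousFunction.norm_le (mul_nonneg (by positivity) (norm_nonneg f))).2
      (abs_cosFormula_le p q |t| fun x => f.1.norm_coe_le_norm x))

theorem cosStar_apply (p q t : ℝ) (f : CLim) (x : ℝ) :
    (cosStar p q t f).1 x = cosFormula p q |t| f.1 x := rfl

/-! ### The operator `Δ*_{p,q}` -/

/-- The second derivative, taken separately on `(-∞, 0]` and on `[0, ∞)`, one-sidedly at `0`
(the value at `0` is `f''(0-)`; on the domain below this is `f''(0+)` as well). -/
def secondDeriv (f : ℝ → ℝ) (x : ℝ) : ℝ :=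
  if x ≤ 0 then iteratedDerivWithin 2 f (Set.Iic 0) x else iteratedDerivWithin 2 f (Set.Ici 0) x

/-- The conditions which define the domain of `Δ*_{p,q}`. -/
structure IsInDomain (p q : ℝ) (f : ℝ → ℝ) : Prop where
  contDiffOn_left : ContDiffOn ℝ 2 f (Set.Iic 0)
  contDiffOn_right : ContDiffOn ℝ 2 f (Set.Ici 0)
  limits : HasFiniteLimits (secondDeriv f)
  transmission : p * derivWithin f (Set.Ici 0) 0 = q * derivWithin f (Set.Iic 0) 0
  second : iteratedDerivWithin 2 f (Set.Ici 0) 0 = iteratedDerivWithin 2 f (Set.Iic 0) 0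

theorem IsInDomain.continuous_secondDeriv {p q : ℝ} {f : ℝ → ℝ} (h : IsInDomain p q f) :
    Continuous (secondDeriv f) := by
  have h1 := h.contDiffOn_left.continuousOn_iteratedDerivWithin (m := 2) le_rfl
    (uniqueDiffOn_Iic 0)
  have h2 := h.contDiffOn_right.continuousOn_iteratedDerivWithin (m := 2) le_rfl
    (uniqueDiffOn_Ici 0)
  unfold secondDeriv
  refine continuous_if_le continuous_id continuous_const h1 h2 ?_
  rintro x rfl
  exact h.second.symm

theorem secondDeriv_add {f g : ℝ → ℝ}
    (hf : ContDiffOn ℝ 2 f (Set.Iic 0)) (hf' : ContDiffOn ℝ 2 f (Set.Ici 0))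
    (hg : ContDiffOn ℝ 2 g (Set.Iic 0)) (hg' : ContDiffOn ℝ 2 g (Set.Ici 0)) :
    secondDeriv (f + g) = secondDeriv f + secondDeriv g := by
  funext x
  simp only [secondDeriv, Pi.add_apply]
  split_ifs with hx
  · exact iteratedDerivWithin_add (s := Set.Iic 0) hx (uniqueDiffOn_Iic 0) (hf x hx) (hg x hx)
  · have hx' : x ∈ Set.Ici (0 : ℝ) := (not_le.1 hx).le
    exact iteratedDerivWithin_add hx' (uniqueDiffOn_Ici 0) (hf' x hx') (hg' x hx')

theorem secondDeriv_smul (c : ℝ) {f : ℝ → ℝ}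
    (hf : ContDiffOn ℝ 2 f (Set.Iic 0)) (hf' : ContDiffOn ℝ 2 f (Set.Ici 0)) :
    secondDeriv (c • f) = c • secondDeriv f := by
  funext x
  simp only [secondDeriv, Pi.smul_apply]
  split_ifs with hx
  · exact iteratedDerivWithin_const_smul (s := Set.Iic 0) hx (uniqueDiffOn_Iic 0) c (hf x hx)
  · have hx' : x ∈ Set.Ici (0 : ℝ) := (not_le.1 hx).le
    exact iteratedDerivWithin_const_smul hx' (uniqueDiffOn_Ici 0) c (hf' x hx')

theorem IsInDomain.add {p q : ℝ} {f g : ℝ → ℝ} (hf : IsInDomain p q f) (hg : IsInDomain p q g) :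
    IsInDomain p q (f + g) where
  contDiffOn_left := hf.contDiffOn_left.add hg.contDiffOn_left
  contDiffOn_right := hf.contDiffOn_right.add hg.contDiffOn_right
  limits := by
    rw [secondDeriv_add hf.contDiffOn_left hf.contDiffOn_right hg.contDiffOn_left
      hg.contDiffOn_right]
    obtain ⟨⟨a, ha⟩, b, hb⟩ := hf.limits
    obtain ⟨⟨a', ha'⟩, b', hb'⟩ := hg.limits
    exact ⟨⟨a + a', ha.add ha'⟩, b + b', hb.add hb'⟩
  transmission := by
    rw [derivWithin_add
        (hf.contDiffOn_right.differentiableOn (by norm_num) 0 Set.self_mem_Ici)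
        (hg.contDiffOn_right.differentiableOn (by norm_num) 0 Set.self_mem_Ici),
      derivWithin_add
        (hf.contDiffOn_left.differentiableOn (by norm_num) 0 Set.self_mem_Iic)
        (hg.contDiffOn_left.differentiableOn (by norm_num) 0 Set.self_mem_Iic),
      mul_add, mul_add, hf.transmission, hg.transmission]
  second := by
    rw [iteratedDerivWithin_add Set.self_mem_Ici (uniqueDiffOn_Ici 0)
        (hf.contDiffOn_right 0 Set.self_mem_Ici) (hg.contDiffOn_right 0 Set.self_mem_Ici),
      iteratedDerivWithin_add Set.self_mem_Iic (uniqueDiffOn_Iic 0)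
        (hf.contDiffOn_left 0 Set.self_mem_Iic) (hg.contDiffOn_left 0 Set.self_mem_Iic),
      hf.second, hg.second]

theorem IsInDomain.smul {p q : ℝ} (c : ℝ) {f : ℝ → ℝ} (hf : IsInDomain p q f) :
    IsInDomain p q (c • f) where
  contDiffOn_left := hf.contDiffOn_left.const_smul c
  contDiffOn_right := hf.contDiffOn_right.const_smul c
  limits := by
    rw [secondDeriv_smul c hf.contDiffOn_left hf.contDiffOn_right]
    obtain ⟨⟨a, ha⟩, b, hb⟩ := hf.limits
    exact ⟨⟨c * a, ha.const_mul c⟩, c * b, hb.const_mul c⟩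
  transmission := by
    have e := hf.transmission
    rw [derivWithin_const_smul c
        (hf.contDiffOn_right.differentiableOn (by norm_num) 0 Set.self_mem_Ici),
      derivWithin_const_smul c
        (hf.contDiffOn_left.differentiableOn (by norm_num) 0 Set.self_mem_Iic),
      smul_eq_mul, smul_eq_mul]
    linear_combination c * e
  second := by
    rw [iteratedDerivWithin_const_smul Set.self_mem_Ici (uniqueDiffOn_Ici 0) c
        (hf.contDiffOn_right 0 Set.self_mem_Ici),
      iteratedDerivWithin_const_smul Set.self_mem_Iic (uniqueDiffOn_Iic 0) c
        (hf.contDiffOn_left 0 Set.self_mem_Iic), hf.second]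

theorem isInDomain_zero (p q : ℝ) : IsInDomain p q (0 : ℝ → ℝ) where
  contDiffOn_left := contDiffOn_const
  contDiffOn_right := contDiffOn_const
  limits := by
    have : secondDeriv (0 : ℝ → ℝ) = 0 := by
      simpa using secondDeriv_smul (0 : ℝ) (f := (0 : ℝ → ℝ)) contDiffOn_const contDiffOn_const
    rw [this]
    exact ⟨⟨0, tendsto_const_nhds⟩, 0, tendsto_const_nhds⟩
  transmission := by simp
  second := by simp

/-- The operator `Δ*_{p,q} f = f''` in `C[-∞, +∞]`, with its domain. -/
def deltaStar (p q : ℝ) : CLim →ₗ.[ℝ] CLim where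
  domain :=
    { carrier := {f | IsInDomain p q f.1}
      add_mem' := fun hf hg => IsInDomain.add hf hg
      zero_mem' := isInDomain_zero p q
      smul_mem' := fun c _ hf => IsInDomain.smul c hf }
  toFun :=
    { toFun := fun f => CLim.mk (secondDeriv f.1.1)
        (IsInDomain.continuous_secondDeriv f.2) (IsInDomain.limits f.2)
      map_add' := fun f g => CLim.ext fun x =>
        congrFun (secondDeriv_add (IsInDomain.contDiffOn_left f.2)
          (IsInDomain.contDiffOn_right f.2) (IsInDomain.contDiffOn_left g.2)
          (IsInDomain.contDiffOn_right g.2)) x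
      map_smul' := fun c f => CLim.ext fun x =>
        congrFun (secondDeriv_smul c (IsInDomain.contDiffOn_left f.2)
          (IsInDomain.contDiffOn_right f.2)) x }

theorem mem_deltaStar_domain (p q : ℝ) (f : CLim) :
    f ∈ (deltaStar p q).domain ↔ IsInDomain p q f.1 := Iff.rfl

theorem deltaStar_apply (p q : ℝ) (f : (deltaStar p q).domain) (x : ℝ) :
    (deltaStar p q f).1 x = secondDeriv f.1.1 x := rfl

end SkewCosine

end

open scoped Topology BoundedContinuousFunction

noncomputable section

namespace SkewCosine

/-! ### One-sided extensions -/

/-! This is the method of images. Put c = (q - p)/(p + q). Each half of f is extended to the whole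
line by a weighted reflection: `extL c f` keeps f on the left half-line and `extR c f` keeps it on
the right. The explicit formula then says that C(t)f is the d'Alembert average of `extL c f` on the
left and of `extR c f` on the right.

The two extensions are tied by the linear relations `extL_eq` and `extR_eq`, which hold at every
point of the line. Averaging commutes with reflection, so it preserves these relations; hence the
averages of the extensions of f are exactly the extensions of C(t)f (`extL_cosStar`,
`extR_cosStar`). As f is recovered from its two extensions, the cosine equation comes from the
classical identity for averages, and strong continuity from the uniform continuity of the
extensions.

The generator is treated the same way. The conditions at 0 say that both extensions have matching
one-sided first and second derivatives there, so f is in the domain with f'' = g if and only if both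
extensions of f are twice differentiable with the extensions of g as second derivatives
(`mem_domain_iff`). A Taylor estimate, uniform in x, turns this into norm convergence of the
difference quotients. Conversely, norm convergence gives pointwise second symmetric derivatives, and
Schwarz's theorem upgrades these to genuine ones.

For the resolvent, the scaled Laplace transform of the averages of G solves l²F - F'' = G
(`hasSecondDeriv_laplace`), and integrating an exact derivative shows that it inverts l² - d²/dx²
from the other side (`HasSecondDeriv.integral_laplace`). -/

/-- The extension of `f` restricted to `(-∞, 0]` to the whole line. -/
def extL (c : ℝ) (f : ℝ → ℝ) (y : ℝ) : ℝ :=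
  if y ≤ 0 then f y else (1 - c) * f y + c * f (-y)

/-- The extension of `f` restricted to `[0, ∞)` to the whole line. -/
def extR (c : ℝ) (f : ℝ → ℝ) (y : ℝ) : ℝ :=
  if y ≤ 0 then (1 + c) * f y - c * f (-y) else f y

theorem extL_of_nonpos (c : ℝ) (f : ℝ → ℝ) {y : ℝ} (hy : y ≤ 0) : extL c f y = f y := if_pos hy

theorem extR_of_nonneg (c : ℝ) (f : ℝ → ℝ) {y : ℝ} (hy : 0 ≤ y) : extR c f y = f y := by
  rcases hy.eq_or_lt with rfl | h
  · simp only [extR, le_refl, if_true, neg_zero]; ring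
  · exact if_neg h.not_ge

theorem extL_of_nonneg (c : ℝ) (f : ℝ → ℝ) {y : ℝ} (hy : 0 ≤ y) :
    extL c f y = (1 - c) * f y + c * f (-y) := by
  rcases hy.eq_or_lt with rfl | h
  · simp only [extL, le_refl, if_true, neg_zero]; ring
  · exact if_neg h.not_ge

theorem extR_of_nonpos (c : ℝ) (f : ℝ → ℝ) {y : ℝ} (hy : y ≤ 0) :
    extR c f y = (1 + c) * f y - c * f (-y) := if_pos hy

/-- Mentioning only the extensions, and not f, this holds for z of either sign. It is therefore
preserved by every linear operation on the line that commutes with reflection. -/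
theorem extL_eq (c : ℝ) (f : ℝ → ℝ) (z : ℝ) :
    extL c f z = (1 - c) * extR c f z + c * extL c f (-z) := by
  rcases le_total z 0 with h | h
  · rw [extL_of_nonpos c f h, extR_of_nonpos c f h, extL_of_nonneg c f (neg_nonneg.2 h), neg_neg]
    ring
  · rw [extL_of_nonneg c f h, extR_of_nonneg c f h, extL_of_nonpos c f (neg_nonpos.2 h)]

theorem extR_eq (c : ℝ) (f : ℝ → ℝ) (z : ℝ) :
    extR c f z = (1 + c) * extL c f z - c * extR c f (-z) := by
  rcases le_total z 0 with h | h
  · rw [extL_of_nonpos c f h, extR_of_nonpos c f h, extR_of_nonneg c f (neg_nonneg.2 h)]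
  · rw [extL_of_nonneg c f h, extR_of_nonneg c f h, extR_of_nonpos c f (neg_nonpos.2 h), neg_neg]
    ring

theorem continuous_extL (c : ℝ) {f : ℝ → ℝ} (hf : Continuous f) : Continuous (extL c f) := by
  unfold extL
  refine Continuous.if_le hf (by fun_prop) continuous_id continuous_const ?_
  rintro x rfl
  simp only [neg_zero]; ring

theorem continuous_extR (c : ℝ) {f : ℝ → ℝ} (hf : Continuous f) : Continuous (extR c f) := by
  unfold extR
  refine Continuous.if_le (by fun_prop) hf continuous_id continuous_const ?_
  rintro x rfl
  simp only [neg_zero]; ring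

theorem hasFiniteLimits_extL (c : ℝ) {f : ℝ → ℝ} (hf : HasFiniteLimits f) :
    HasFiniteLimits (extL c f) := by
  obtain ⟨⟨a, ha⟩, b, hb⟩ := hf
  refine ⟨⟨(1 - c) * a + c * b, ?_⟩, b, hb.congr' ?_⟩
  · refine ((ha.const_mul (1 - c)).add
      ((hb.comp Filter.tendsto_neg_atTop_atBot).const_mul c)).congr' ?_
    filter_upwards [Filter.eventually_ge_atTop 0] with x hx
    exact (extL_of_nonneg c f hx).symm
  · filter_upwards [Filter.eventually_le_atBot 0] with x hx
    exact (extL_of_nonpos c f hx).symm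

theorem hasFiniteLimits_extR (c : ℝ) {f : ℝ → ℝ} (hf : HasFiniteLimits f) :
    HasFiniteLimits (extR c f) := by
  obtain ⟨⟨a, ha⟩, b, hb⟩ := hf
  refine ⟨⟨a, ha.congr' ?_⟩, (1 + c) * b - c * a, ?_⟩
  · filter_upwards [Filter.eventually_ge_atTop 0] with x hx
    exact (extR_of_nonneg c f hx).symm
  · refine ((hb.const_mul (1 + c)).sub
      ((ha.comp Filter.tendsto_neg_atBot_atTop).const_mul c)).congr' ?_
    filter_upwards [Filter.eventually_le_atBot 0] with x hx
    exact (extR_of_nonpos c f hx).symm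

/-- Evaluation at a point, as a bounded functional. -/
def evalAt (x : ℝ) : CLim →L[ℝ] ℝ :=
  LinearMap.mkContinuous
    { toFun := fun f : CLim => f.1 x
      map_add' := fun _ _ => rfl
      map_smul' := fun _ _ => rfl } 1
    (fun f => by rw [one_mul]; exact f.1.norm_coe_le_norm x)

/-- Evaluation of `extL c f` at a point, as a bounded functional of `f`. -/
def evalL (c x : ℝ) : CLim →L[ℝ] ℝ :=
  if x ≤ 0 then evalAt x else (1 - c) • evalAt x + c • evalAt (-x)

/-- Evaluation of `extR c f` at a point, as a bounded functional of `f`. -/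
def evalR (c x : ℝ) : CLim →L[ℝ] ℝ :=
  if x ≤ 0 then (1 + c) • evalAt x - c • evalAt (-x) else evalAt x

theorem evalL_apply (c x : ℝ) (f : CLim) : evalL c x f = extL c f.1 x := by
  unfold evalL extL
  split_ifs <;> rfl

theorem evalR_apply (c x : ℝ) (f : CLim) : evalR c x f = extR c f.1 x := by
  unfold evalR extR
  split_ifs <;> rfl

theorem norm_le_of_ext (c : ℝ) {f : CLim} {M : ℝ} (hM : 0 ≤ M)
    (hL : ∀ x ≤ 0, |extL c f.1 x| ≤ M) (hR : ∀ x, 0 ≤ x → |extR c f.1 x| ≤ M) : ‖f‖ ≤ M := by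
  refine (BoundedContinuousFunction.norm_le hM).2 fun x => ?_
  rcases le_total x 0 with h | h
  · exact extL_of_nonpos c f.1 h ▸ hL x h
  · exact extR_of_nonneg c f.1 h ▸ hR x h

theorem eq_of_ext (c : ℝ) {f g : CLim} (hL : ∀ x, extL c f.1 x = extL c g.1 x)
    (hR : ∀ x, extR c f.1 x = extR c g.1 x) : f = g := by
  refine CLim.ext fun x => ?_
  rcases le_total x 0 with h | h
  · simpa only [extL_of_nonpos c _ h] using hL x
  · simpa only [extR_of_nonneg c _ h] using hR x

/-! ### The skewness parameter and d'Alembert's formula -/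

/-- The skewness parameter `(q - p) / (p + q)`. -/
def skew (p q : ℝ) : ℝ := (q - p) / (p + q)

/-- d'Alembert's average. -/
def avg (F : ℝ → ℝ) (t x : ℝ) : ℝ := (F (x + t) + F (x - t)) / 2

theorem avg_abs (F : ℝ → ℝ) (t x : ℝ) : avg F |t| x = avg F t x := by
  unfold avg
  rcases abs_choice t with h | h <;> rw [h]
  rw [sub_neg_eq_add, ← sub_eq_add_neg, add_comm]

/-- For x ≤ 0 only x + |t| can cross the origin. When it does, the reflected part of `extL` produces
the correction term of the formula, whose weight is c/2 because of the average. -/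
theorem cosStar_of_nonpos (p q t : ℝ) (f : CLim) {x : ℝ} (hx : x ≤ 0) :
    (cosStar p q t f).1 x = avg (extL (skew p q) f.1) t x := by
  rw [cosStar_apply, ← avg_abs]
  generalize ht : |t| = s
  have hs : 0 ≤ s := ht ▸ abs_nonneg t
  have e : (q - p) / (2 * (p + q)) = skew p q / 2 := by
    unfold skew; rw [mul_comm 2, div_div]
  unfold cosFormula avg
  rw [if_pos hx, abs_of_nonpos hx, extL_of_nonpos _ _ (by linarith : x - s ≤ 0), e]
  split_ifs with h
  · rw [extL_of_nonpos _ _ (by linarith : x + s ≤ 0)]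
  · rw [extL_of_nonneg _ _ (by linarith : 0 ≤ x + s), neg_add, ← sub_eq_add_neg]
    ring

theorem cosStar_of_pos (p q t : ℝ) (f : CLim) {x : ℝ} (hx : 0 < x) :
    (cosStar p q t f).1 x = avg (extR (skew p q) f.1) t x := by
  rw [cosStar_apply, ← avg_abs]
  generalize ht : |t| = s
  have hs : 0 ≤ s := ht ▸ abs_nonneg t
  have e : (p - q) / (2 * (p + q)) = -skew p q / 2 := by
    unfold skew; rw [mul_comm 2, ← neg_div, neg_sub, div_div]
  unfold cosFormula avg
  rw [if_neg hx.not_ge, abs_of_pos hx, extR_of_nonneg _ _ (by linarith : 0 ≤ x + s), e]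
  split_ifs with h
  · rw [extR_of_nonneg _ _ (by linarith : 0 ≤ x - s)]
  · rw [extR_of_nonpos _ _ (by linarith : x - s ≤ 0), neg_sub]
    ring

/-- Averaging is linear, and averaging at -z is averaging the reflected function at z. -/
theorem avg_extL_eq (c : ℝ) (f : ℝ → ℝ) (t z : ℝ) :
    avg (extL c f) t z = (1 - c) * avg (extR c f) t z + c * avg (extL c f) t (-z) := by
  unfold avg
  rw [extL_eq c f (z + t), extL_eq c f (z - t), neg_add, neg_sub, ← sub_eq_add_neg,
    sub_eq_add_neg t, add_comm t]
  ring

theorem avg_extR_eq (c : ℝ) (f : ℝ → ℝ) (t z : ℝ) :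
    avg (extR c f) t z = (1 + c) * avg (extL c f) t z - c * avg (extR c f) t (-z) := by
  unfold avg
  rw [extR_eq c f (z + t), extR_eq c f (z - t), neg_add, neg_sub, ← sub_eq_add_neg,
    sub_eq_add_neg t, add_comm t]
  ring

theorem cosStar_zero_point (p q t : ℝ) (f : CLim) :
    avg (extL (skew p q) f.1) t 0 = avg (extR (skew p q) f.1) t 0 := by
  have h1 := avg_extL_eq (skew p q) f.1 t 0
  have h2 := avg_extR_eq (skew p q) f.1 t 0
  rw [neg_zero] at h1 h2
  -- The first relation alone says nothing when c = 1 and the second nothing when c = -1; half their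
  -- difference works for every c.
  linear_combination (h1 - h2) / 2

theorem cosStar_of_nonneg (p q t : ℝ) (f : CLim) {x : ℝ} (hx : 0 ≤ x) :
    (cosStar p q t f).1 x = avg (extR (skew p q) f.1) t x := by
  rcases hx.eq_or_lt with rfl | h
  · rw [cosStar_of_nonpos p q t f le_rfl, cosStar_zero_point]
  · exact cosStar_of_pos p q t f h

/-- The intertwining property that reduces the family to d'Alembert's on the line: on the right
half-line the extension of C(t)f mixes both averages, and `avg_extL_eq` recombines them. -/
theorem extL_cosStar (p q t : ℝ) (f : CLim) (x : ℝ) :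
    extL (skew p q) (cosStar p q t f).1 x = avg (extL (skew p q) f.1) t x := by
  rcases le_total x 0 with h | h
  · rw [extL_of_nonpos _ _ h, cosStar_of_nonpos p q t f h]
  · rw [extL_of_nonneg _ _ h, cosStar_of_nonneg p q t f h,
      cosStar_of_nonpos p q t f (neg_nonpos.2 h), ← avg_extL_eq]

theorem extR_cosStar (p q t : ℝ) (f : CLim) (x : ℝ) :
    extR (skew p q) (cosStar p q t f).1 x = avg (extR (skew p q) f.1) t x := by
  rcases le_total x 0 with h | h
  · rw [extR_of_nonpos _ _ h, cosStar_of_nonneg p q t f (neg_nonneg.2 h),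
      cosStar_of_nonpos p q t f h, ← avg_extR_eq]
  · rw [extR_of_nonneg _ _ h, cosStar_of_nonneg p q t f h]

/-! ### The cosine family -/

theorem cosStar_zero (p q : ℝ) : cosStar p q 0 = ContinuousLinearMap.id ℝ CLim := by
  refine ContinuousLinearMap.ext fun f => eq_of_ext (skew p q) (fun x => ?_) fun x => ?_
  · rw [extL_cosStar]; simp [avg]
  · rw [extR_cosStar]; simp [avg]

theorem avg_avg (F : ℝ → ℝ) (t s x : ℝ) :
    2 * avg (avg F s) t x = avg F (t + s) x + avg F (t - s) x := by
  unfold avg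
  rw [show x + t + s = x + (t + s) by ring, show x + t - s = x + (t - s) by ring,
    show x - t + s = x - (t - s) by ring, show x - t - s = x - (t + s) by ring]
  ring

theorem cosStar_dAlembert (p q t s : ℝ) :
    (2 : ℝ) • (cosStar p q t ∘L cosStar p q s) = cosStar p q (t + s) + cosStar p q (t - s) := by
  refine ContinuousLinearMap.ext fun f => eq_of_ext (skew p q) (fun x => ?_) fun x => ?_
  · simp only [← evalL_apply]
    simp only [smul_apply, add_apply, map_add, map_smul,
      ContinuousLinearMap.comp_apply, smul_eq_mul]
    simp only [evalL_apply, extL_cosStar]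
    rw [← avg_avg, funext (extL_cosStar p q s f)]
  · simp only [← evalR_apply]
    simp only [smul_apply, add_apply, map_add, map_smul,
      ContinuousLinearMap.comp_apply, smul_eq_mul]
    simp only [evalR_apply, extR_cosStar]
    rw [← avg_avg, funext (extR_cosStar p q s f)]

/-- Subtracting a multiple of arctan, itself Lipschitz, equalises the two limits; a continuous
function with one limit at infinity is uniformly continuous. -/
theorem HasFiniteLimits.uniformContinuous {f : ℝ → ℝ} (hc : Continuous f)
    (h : HasFiniteLimits f) : UniformContinuous f := by
  obtain ⟨⟨a, ha⟩, b, hb⟩ := h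
  have hA : UniformContinuous Real.arctan := by
    refine LipschitzWith.uniformContinuous (K := 1) ?_
    refine lipschitzWith_of_nnnorm_deriv_le Real.differentiable_arctan fun x => ?_
    rw [← NNReal.coe_le_coe, coe_nnnorm, Real.deriv_arctan, Real.norm_eq_abs, NNReal.coe_one,
      abs_of_pos (by positivity)]
    exact div_le_one_of_le₀ (by nlinarith [sq_nonneg x]) (by positivity)
  -- This slope moves both limits to (a + b)/2.
  set k : ℝ := (a - b) / Real.pi with hk
  have hkp : k * (Real.pi / 2) = (a - b) / 2 := by
    rw [hk]; field_simp
  have h1 : UniformContinuous fun x => f x - k * Real.arctan x := by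
    refine (hc.sub (continuous_const.mul Real.continuous_arctan)).uniformContinuous_of_tendsto_cocompact
      (x := (a + b) / 2) ?_
    rw [cocompact_eq_atBot_atTop, Filter.tendsto_sup]
    constructor
    · have := hb.sub ((Real.tendsto_arctan_atBot.mono_right nhdsWithin_le_nhds).const_mul k)
      rwa [show b - k * -(Real.pi / 2) = (a + b) / 2 by linear_combination hkp] at this
    · have := ha.sub ((Real.tendsto_arctan_atTop.mono_right nhdsWithin_le_nhds).const_mul k)
      rwa [show a - k * (Real.pi / 2) = (a + b) / 2 by linear_combination -hkp] at this
  have h2 := h1.add (hA.const_mul' k)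
  simpa using h2

theorem uniformContinuous_extL (c : ℝ) (f : CLim) : UniformContinuous (extL c f.1) :=
  (hasFiniteLimits_extL c f.2).uniformContinuous (continuous_extL c f.1.continuous)

theorem uniformContinuous_extR (c : ℝ) (f : CLim) : UniformContinuous (extR c f.1) :=
  (hasFiniteLimits_extR c f.2).uniformContinuous (continuous_extR c f.1.continuous)

theorem abs_avg_sub_avg_le {F : ℝ → ℝ} {δ ε : ℝ} (h : ∀ a b, dist a b < δ → dist (F a) (F b) < ε)
    {t s : ℝ} (hts : dist t s < δ) (x : ℝ) : |avg F t x - avg F s x| ≤ ε := by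
  have h1 := h (x + t) (x + s) (by simpa using hts)
  have h2 := h (x - t) (x - s) (by rwa [dist_sub_left])
  rw [Real.dist_eq, abs_lt] at h1 h2
  unfold avg
  rw [abs_le]
  constructor <;> linarith [h1.1, h1.2, h2.1, h2.2]

theorem continuous_cosStar (p q : ℝ) (f : CLim) : Continuous fun t => cosStar p q t f := by
  rw [Metric.continuous_iff]
  intro s ε hε
  obtain ⟨δ, hδ, h1⟩ := Metric.uniformContinuous_iff.1 (uniformContinuous_extL (skew p q) f)
    (ε / 2) (half_pos hε)
  obtain ⟨δ', hδ', h2⟩ := Metric.uniformContinuous_iff.1 (uniformContinuous_extR (skew p q) f)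
    (ε / 2) (half_pos hε)
  refine ⟨min δ δ', lt_min hδ hδ', fun t ht => ?_⟩
  rw [dist_eq_norm]
  refine (norm_le_of_ext (skew p q) (half_pos hε).le (fun x _ => ?_) fun x _ => ?_).trans_lt
    (half_lt_self hε)
  · rw [← evalL_apply, map_sub, evalL_apply, evalL_apply, extL_cosStar, extL_cosStar]
    exact abs_avg_sub_avg_le (fun a b h => h1 h) (ht.trans_le (min_le_left _ _)) x
  · rw [← evalR_apply, map_sub, evalR_apply, evalR_apply, extR_cosStar, extR_cosStar]
    exact abs_avg_sub_avg_le (fun a b h => h2 h) (ht.trans_le (min_le_right _ _)) x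

theorem isStronglyContinuousCosineFamily_cosStar (p q : ℝ) :
    IsStronglyContinuousCosineFamily (cosStar p q) where
  zero := cosStar_zero p q
  dAlembert := cosStar_dAlembert p q
  strong_continuity := continuous_cosStar p q

/-! ### The norm bound -/

theorem cosStar_abs (p q t : ℝ) : cosStar p q |t| = cosStar p q t := by
  refine ContinuousLinearMap.ext fun f => CLim.ext fun x => ?_
  rw [cosStar_apply, cosStar_apply, abs_abs]

theorem abs_mul_add_mul_le {a b u v M : ℝ} (hu : |u| ≤ M) (hv : |v| ≤ M) :
    |a * u + b * v| ≤ (|a| + |b|) * M := by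
  refine (abs_add_le _ _).trans ?_
  rw [abs_mul, abs_mul, add_mul]
  gcongr

theorem abs_extL_le {c : ℝ} {f : ℝ → ℝ} {M : ℝ} (hM : ∀ x, |f x| ≤ M) (x : ℝ) :
    |extL c f x| ≤ (|1 - c| + |c|) * M := by
  have hM0 : 0 ≤ M := (abs_nonneg _).trans (hM 0)
  rcases le_total x 0 with h | h
  · have h1 : (1 : ℝ) ≤ |1 - c| + |c| := by
      simpa using abs_add_le (1 - c) c
    rw [extL_of_nonpos c f h]
    exact (hM x).trans (le_mul_of_one_le_left hM0 h1)
  · rw [extL_of_nonneg c f h]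
    exact abs_mul_add_mul_le (hM _) (hM _)

theorem abs_extR_le {c : ℝ} {f : ℝ → ℝ} {M : ℝ} (hM : ∀ x, |f x| ≤ M) (x : ℝ) :
    |extR c f x| ≤ (|1 + c| + |c|) * M := by
  have hM0 : 0 ≤ M := (abs_nonneg _).trans (hM 0)
  rcases le_total x 0 with h | h
  · rw [extR_of_nonpos c f h, sub_eq_add_neg, ← neg_mul, ← abs_neg c]
    exact abs_mul_add_mul_le (hM _) (hM _)
  · have h1 : (1 : ℝ) ≤ |1 + c| + |c| := by
      simpa using abs_sub (1 + c) c
    rw [extR_of_nonneg c f h]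
    exact (hM x).trans (le_mul_of_one_le_left hM0 h1)

/-- On the left one of the two averaged values is a value of f itself, so the bound is half of 1 +
|1 - c| + |c|. Since |c| ≤ 1 this equals (2 - c + |c|)/2 ≤ 1 + |c|; the right side is symmetric. -/
theorem norm_cosStar_le_one_add_abs (p q t : ℝ) (hc : |skew p q| ≤ 1) :
    ‖cosStar p q t‖ ≤ 1 + |skew p q| := by
  rw [← cosStar_abs]
  have ht := abs_nonneg t
  generalize |t| = s at ht
  refine ContinuousLinearMap.opNorm_le_bound _ (by positivity) fun f => ?_
  have hf : ∀ x, |f.1 x| ≤ ‖f‖ := fun x => f.1.norm_coe_le_norm x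
  have hf0 := norm_nonneg f
  have hc' := abs_le.1 hc
  refine norm_le_of_ext (skew p q) (by positivity) (fun x hx => ?_) fun x hx => ?_
  · rw [extL_cosStar]
    have h1 := abs_extL_le (c := skew p q) hf (x + s)
    have h2 := hf (x - s)
    rw [abs_of_nonneg (by linarith [hc'.2] : 0 ≤ 1 - skew p q)] at h1
    unfold avg
    rw [extL_of_nonpos _ _ (by linarith : x - s ≤ 0), abs_div, abs_two]
    nlinarith [abs_add_le (extL (skew p q) f.1 (x + s)) (f.1 (x - s)),
      neg_abs_le (skew p q), mul_le_mul_of_nonneg_right (neg_abs_le (skew p q)) hf0]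
  · rw [extR_cosStar]
    have h1 := abs_extR_le (c := skew p q) hf (x - s)
    have h2 := hf (x + s)
    rw [abs_of_nonneg (by linarith [hc'.1] : 0 ≤ 1 + skew p q)] at h1
    unfold avg
    rw [extR_of_nonneg _ _ (by linarith : 0 ≤ x + s), abs_div, abs_two]
    nlinarith [abs_add_le (f.1 (x + s)) (extR (skew p q) f.1 (x - s)),
      le_abs_self (skew p q), mul_le_mul_of_nonneg_right (le_abs_self (skew p q)) hf0]

theorem norm_cosStar_le {p q : ℝ} (hp : 0 ≤ p) (hq : 0 ≤ q) (hpq : 0 < p + q) (t : ℝ) :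
    ‖cosStar p q t‖ ≤ 2 * max p q / (p + q) := by
  have h1 : |skew p q| ≤ 1 := by
    unfold skew
    rw [abs_div, abs_of_pos hpq, div_le_one hpq, abs_le]
    constructor <;> linarith
  refine (norm_cosStar_le_one_add_abs p q t h1).trans (le_of_eq ?_)
  unfold skew
  rw [abs_div, abs_of_pos hpq, eq_div_iff hpq.ne', add_mul, div_mul_cancel₀ _ hpq.ne']
  rcases le_total p q with h | h
  · rw [max_eq_right h, abs_of_nonneg (sub_nonneg.2 h)]; ring
  · rw [max_eq_left h, abs_of_nonpos (sub_nonpos.2 h)]; ring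

/-! ### Twice differentiable functions on the line -/

/-- `F` is twice differentiable on `ℝ` with second derivative `G`. -/
def HasSecondDeriv (F G : ℝ → ℝ) : Prop :=
  ∃ F₁ : ℝ → ℝ, (∀ x, HasDerivAt F (F₁ x) x) ∧ ∀ x, HasDerivAt F₁ (G x) x

theorem hasDerivAt_ite {u v u' v' : ℝ → ℝ}
    (hu : ∀ x ∈ Set.Iic (0 : ℝ), HasDerivWithinAt u (u' x) (Set.Iic 0) x)
    (hv : ∀ x ∈ Set.Ici (0 : ℝ), HasDerivWithinAt v (v' x) (Set.Ici 0) x)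
    (h0 : u 0 = v 0) (h1 : u' 0 = v' 0) (x : ℝ) :
    HasDerivAt (fun y => if y ≤ 0 then u y else v y) (if x ≤ 0 then u' x else v' x) x := by
  have eL : ∀ y ∈ Set.Iic (0 : ℝ), (if y ≤ 0 then u y else v y) = u y := fun y hy => if_pos hy
  have eR : ∀ y ∈ Set.Ici (0 : ℝ), (if y ≤ 0 then u y else v y) = v y := fun y hy => by
    rcases (Set.mem_Ici.1 hy).eq_or_lt with rfl | h
    · simpa using h0
    · exact if_neg h.not_ge
  rcases lt_trichotomy x 0 with h | rfl | h
  · rw [if_pos h.le]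
    exact ((hu x h.le).congr eL (eL x h.le)).hasDerivAt (Iic_mem_nhds h)
  · rw [if_pos le_rfl]
    have a := (hu 0 Set.self_mem_Iic).congr eL (eL 0 Set.self_mem_Iic)
    have b := (hv 0 Set.self_mem_Ici).congr eR (eR 0 Set.self_mem_Ici)
    rw [← h1] at b
    have := a.union b
    rwa [Set.Iic_union_Ici, hasDerivWithinAt_univ] at this
  · rw [if_neg h.not_ge]
    exact ((hv x h.le).congr eR (eR x h.le)).hasDerivAt (Ici_mem_nhds h)

theorem hasDerivWithinAt_of_contDiffOn {f : ℝ → ℝ} {s : Set ℝ} (hs : UniqueDiffOn ℝ s)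
    (hf : ContDiffOn ℝ 2 f s) {x : ℝ} (hx : x ∈ s) :
    HasDerivWithinAt f (derivWithin f s x) s x ∧
      HasDerivWithinAt (derivWithin f s) (iteratedDerivWithin 2 f s x) s x := by
  have h2 : ContDiffOn ℝ (1 + 1) f s := by rwa [one_add_one_eq_two]
  have h1 := ((contDiffOn_succ_iff_derivWithin hs).1 h2).2.2
  refine ⟨(hf.differentiableOn (by norm_num) x hx).hasDerivWithinAt, ?_⟩
  have e : iteratedDerivWithin 2 f s x = derivWithin (derivWithin f s) s x := by
    rw [show (2 : ℕ) = 1 + 1 from rfl, iteratedDerivWithin_succ]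
    exact derivWithin_congr (fun y _ => congrFun iteratedDerivWithin_one y)
      (congrFun iteratedDerivWithin_one x)
  rw [e]
  exact (h1.differentiableOn (by norm_num) x hx).hasDerivWithinAt

theorem contDiffOn_of_hasDerivWithinAt {f f₁ m : ℝ → ℝ} {s : Set ℝ} (hs : UniqueDiffOn ℝ s)
    (h1 : ∀ x ∈ s, HasDerivWithinAt f (f₁ x) s x)
    (h2 : ∀ x ∈ s, HasDerivWithinAt f₁ (m x) s x) (hm : ContinuousOn m s) :
    ContDiffOn ℝ 2 f s ∧
      ∀ x ∈ s, derivWithin f s x = f₁ x ∧ iteratedDerivWithin 2 f s x = m x := by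
  have e1 : ∀ x ∈ s, derivWithin f s x = f₁ x := fun x hx => (h1 x hx).derivWithin (hs x hx)
  have h2' : ∀ x ∈ s, HasDerivWithinAt (derivWithin f s) (m x) s x := fun x hx =>
    (h2 x hx).congr e1 (e1 x hx)
  have e2 : ∀ x ∈ s, derivWithin (derivWithin f s) s x = m x := fun x hx =>
    (h2' x hx).derivWithin (hs x hx)
  refine ⟨?_, fun x hx => ⟨e1 x hx, ?_⟩⟩
  · rw [← one_add_one_eq_two, contDiffOn_succ_iff_derivWithin hs]
    refine ⟨fun x hx => (h1 x hx).differentiableWithinAt, by simp, ?_⟩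
    rw [← zero_add (1 : WithTop ℕ∞), contDiffOn_succ_iff_derivWithin hs]
    exact ⟨fun x hx => (h2' x hx).differentiableWithinAt, by simp,
      contDiffOn_zero.2 (hm.congr e2)⟩
  · rw [show (2 : ℕ) = 1 + 1 from rfl, iteratedDerivWithin_succ, ← e2 x hx]
    exact derivWithin_congr (fun y _ => congrFun iteratedDerivWithin_one y)
      (congrFun iteratedDerivWithin_one x)

/-! ### The domain of `Δ*_{p,q}` in terms of the two extensions. -/

theorem hasDerivWithinAt_comp_neg_Ici {f : ℝ → ℝ} {f' x : ℝ}
    (h : HasDerivWithinAt f f' (Set.Iic 0) (-x)) :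
    HasDerivWithinAt (fun y => f (-y)) (-f') (Set.Ici 0) x := by
  have := HasDerivWithinAt.scomp (t' := Set.Iic 0) x h (hasDerivAt_neg x).hasDerivWithinAt
    (s := Set.Ici 0) (fun y hy => Set.mem_Iic.2 (neg_nonpos.2 hy))
  simpa [Function.comp_def] using this

theorem hasDerivWithinAt_comp_neg_Iic {f : ℝ → ℝ} {f' x : ℝ}
    (h : HasDerivWithinAt f f' (Set.Ici 0) (-x)) :
    HasDerivWithinAt (fun y => f (-y)) (-f') (Set.Iic 0) x := by
  have := HasDerivWithinAt.scomp (t' := Set.Ici 0) x h (hasDerivAt_neg x).hasDerivWithinAt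
    (s := Set.Iic 0) (fun y hy => Set.mem_Ici.2 (neg_nonneg.2 hy))
  simpa [Function.comp_def] using this

theorem hasDerivAt_comp_neg {f : ℝ → ℝ} {f' x : ℝ} (h : HasDerivAt f f' (-x)) :
    HasDerivAt (fun y => f (-y)) (-f') x := by
  have := HasDerivAt.comp x h (hasDerivAt_neg x)
  rwa [mul_neg_one] at this

theorem secondDeriv_of_nonneg {p q : ℝ} {f : ℝ → ℝ} (h : IsInDomain p q f) {x : ℝ} (hx : 0 ≤ x) :
    secondDeriv f x = iteratedDerivWithin 2 f (Set.Ici 0) x := by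
  rcases hx.eq_or_lt with rfl | hx
  · rw [secondDeriv, if_pos le_rfl, h.second]
  · exact if_neg hx.not_ge

/-- Here 1 - c = 2p/(p + q) and 1 + c = 2q/(p + q). -/
theorem IsInDomain.skew_transmission {p q : ℝ} (hpq : p + q ≠ 0) {f : ℝ → ℝ}
    (h : IsInDomain p q f) : (1 - skew p q) * derivWithin f (Set.Ici 0) 0 =
      (1 + skew p q) * derivWithin f (Set.Iic 0) 0 := by
  have := h.transmission
  unfold skew
  field_simp
  linear_combination 2 * this

theorem IsInDomain.hasDerivWithinAt_left {p q : ℝ} {f : ℝ → ℝ} (h : IsInDomain p q f) {x : ℝ}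
    (hx : x ≤ 0) : HasDerivWithinAt f (derivWithin f (Set.Iic 0) x) (Set.Iic 0) x ∧
      HasDerivWithinAt (derivWithin f (Set.Iic 0)) (secondDeriv f x) (Set.Iic 0) x := by
  rw [secondDeriv, if_pos hx]
  exact hasDerivWithinAt_of_contDiffOn (uniqueDiffOn_Iic 0) h.contDiffOn_left hx

theorem IsInDomain.hasDerivWithinAt_right {p q : ℝ} {f : ℝ → ℝ} (h : IsInDomain p q f) {x : ℝ}
    (hx : 0 ≤ x) : HasDerivWithinAt f (derivWithin f (Set.Ici 0) x) (Set.Ici 0) x ∧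
      HasDerivWithinAt (derivWithin f (Set.Ici 0)) (secondDeriv f x) (Set.Ici 0) x := by
  rw [secondDeriv_of_nonneg h hx]
  exact hasDerivWithinAt_of_contDiffOn (uniqueDiffOn_Ici 0) h.contDiffOn_right hx

/-- Reflection changes the sign of the first derivative and not of the second. Matching first
derivatives at 0 is thus the transmission condition, and the second derivatives match because
f''(0+) = f''(0-) and the weights 1 - c and c add up to 1. -/
theorem IsInDomain.hasSecondDeriv_extL {p q : ℝ} (hpq : p + q ≠ 0) {f : ℝ → ℝ}
    (h : IsInDomain p q f) :
    HasSecondDeriv (extL (skew p q) f) (extL (skew p q) (secondDeriv f)) := by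
  have ht := h.skew_transmission hpq
  generalize skew p q = c at ht
  refine ⟨fun x => if x ≤ 0 then derivWithin f (Set.Iic 0) x else
    (1 - c) * derivWithin f (Set.Ici 0) x + c * -derivWithin f (Set.Iic 0) (-x),
    hasDerivAt_ite (fun x hx => (h.hasDerivWithinAt_left hx).1) (fun x hx => ?_) ?_ ?_,
    hasDerivAt_ite (fun x hx => (h.hasDerivWithinAt_left hx).2) (fun x hx => ?_) ?_ ?_⟩
  · exact ((h.hasDerivWithinAt_right hx).1.const_mul _).add
      ((hasDerivWithinAt_comp_neg_Ici (h.hasDerivWithinAt_left (neg_nonpos.2 hx)).1).const_mul _)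
  · rw [neg_zero]; ring
  · rw [neg_zero]; linear_combination -ht
  · have := ((h.hasDerivWithinAt_right hx).2.const_mul (1 - c)).add
      ((hasDerivWithinAt_comp_neg_Ici
        (h.hasDerivWithinAt_left (neg_nonpos.2 hx)).2).neg.const_mul c)
    rwa [neg_neg] at this
  · rw [neg_zero]; linear_combination -ht
  · rw [neg_zero]; ring

theorem IsInDomain.hasSecondDeriv_extR {p q : ℝ} (hpq : p + q ≠ 0) {f : ℝ → ℝ}
    (h : IsInDomain p q f) :
    HasSecondDeriv (extR (skew p q) f) (extR (skew p q) (secondDeriv f)) := by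
  have ht := h.skew_transmission hpq
  generalize skew p q = c at ht
  refine ⟨fun x => if x ≤ 0 then
    (1 + c) * derivWithin f (Set.Iic 0) x - c * -derivWithin f (Set.Ici 0) (-x) else
      derivWithin f (Set.Ici 0) x,
    hasDerivAt_ite (fun x hx => ?_) (fun x hx => (h.hasDerivWithinAt_right hx).1) ?_ ?_,
    hasDerivAt_ite (fun x hx => ?_) (fun x hx => (h.hasDerivWithinAt_right hx).2) ?_ ?_⟩
  · exact ((h.hasDerivWithinAt_left hx).1.const_mul _).sub
      ((hasDerivWithinAt_comp_neg_Iic (h.hasDerivWithinAt_right (neg_nonneg.2 hx)).1).const_mul _)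
  · rw [neg_zero]; ring
  · rw [neg_zero]; linear_combination -ht
  · have := ((h.hasDerivWithinAt_left hx).2.const_mul (1 + c)).sub
      ((hasDerivWithinAt_comp_neg_Iic
        (h.hasDerivWithinAt_right (neg_nonneg.2 hx)).2).neg.const_mul c)
    rwa [neg_neg] at this
  · rw [neg_zero]; linear_combination -ht
  · rw [neg_zero]; ring

theorem isInDomain_of_hasSecondDeriv {p q : ℝ} (hpq : p + q ≠ 0) {f m : ℝ → ℝ}
    (hm : Continuous m) (hlim : HasFiniteLimits m)
    (hL : HasSecondDeriv (extL (skew p q) f) (extL (skew p q) m))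
    (hR : HasSecondDeriv (extR (skew p q) f) (extR (skew p q) m)) :
    IsInDomain p q f ∧ secondDeriv f = m := by
  obtain ⟨L₁, hL1, hL2⟩ := hL
  obtain ⟨R₁, hR1, hR2⟩ := hR
  obtain ⟨cL, eL⟩ := contDiffOn_of_hasDerivWithinAt (f := f) (f₁ := L₁) (m := m) (uniqueDiffOn_Iic 0)
    (fun x hx => (hL1 x).hasDerivWithinAt.congr (fun y hy => (extL_of_nonpos _ f hy).symm)
      (extL_of_nonpos _ f hx).symm)
    (fun x hx => extL_of_nonpos (skew p q) m hx ▸ (hL2 x).hasDerivWithinAt) hm.continuousOn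
  obtain ⟨cR, eR⟩ := contDiffOn_of_hasDerivWithinAt (f := f) (f₁ := R₁) (m := m) (uniqueDiffOn_Ici 0)
    (fun x hx => (hR1 x).hasDerivWithinAt.congr (fun y hy => (extR_of_nonneg _ f hy).symm)
      (extR_of_nonneg _ f hx).symm)
    (fun x hx => extR_of_nonneg (skew p q) m hx ▸ (hR2 x).hasDerivWithinAt) hm.continuousOn
  have e : secondDeriv f = m := by
    funext x
    unfold secondDeriv
    split_ifs with hx
    · exact (eL x hx).2
    · exact (eR x (not_le.1 hx).le).2
  refine ⟨⟨cL, cR, e ▸ hlim, ?_, ?_⟩, e⟩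
  · rw [(eR 0 Set.self_mem_Ici).1, (eL 0 Set.self_mem_Iic).1]
    -- Differentiating `extL_eq` at 0 gives L₁(0) = (1 - c) R₁(0) - c L₁(0), which is the
    -- transmission condition.
    have hn : HasDerivAt (fun z => extL (skew p q) f (-z)) (-L₁ 0) 0 := by
      have := hasDerivAt_comp_neg (x := 0) (hL1 (-0))
      rwa [neg_zero] at this
    have h := ((hR1 0).const_mul (1 - skew p q)).add (hn.const_mul (skew p q))
    have h' := (hL1 0).unique (h.congr_of_eventuallyEq (.of_forall fun z => extL_eq (skew p q) f z))
    unfold skew at h'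
    field_simp at h'
    linear_combination -h' / 2
  · rw [(eR 0 Set.self_mem_Ici).2, (eL 0 Set.self_mem_Iic).2]

/-! ### Second symmetric differences -/

/-- The second symmetric difference quotient of `F`. -/
def symQuot (F : ℝ → ℝ) (x t : ℝ) : ℝ := 2 / t ^ 2 * (avg F t x - F x)

theorem abs_le_of_hasDerivAt_le {φ φ' : ℝ → ℝ} {t K : ℝ} (hφ : ∀ s, HasDerivAt φ (φ' s) s)
    (h0 : φ 0 = 0) (hb : ∀ s ∈ Set.Icc 0 t, |φ' s| ≤ K) {s : ℝ} (hs : s ∈ Set.Icc 0 t) :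
    |φ s| ≤ K * s := by
  have := (convex_Icc (0 : ℝ) t).norm_image_sub_le_of_norm_hasDerivWithin_le
    (fun x _ => (hφ x).hasDerivWithinAt) hb (Set.left_mem_Icc.2 (hs.1.trans hs.2)) hs
  rwa [h0, sub_zero, sub_zero, Real.norm_eq_abs, Real.norm_eq_abs, abs_of_nonneg hs.1] at this

/-- The function r ↦ F(x + r) + F(x - r) - 2F(x) - r²G(x) vanishes at 0 with its first derivative,
and its second derivative is at most 2ε for small r; the mean value inequality is applied twice. The
bound does not depend on x, which is what norm convergence needs. -/
theorem HasSecondDeriv.abs_symQuot_sub_le {F G : ℝ → ℝ} (h : HasSecondDeriv F G) {δ ε : ℝ}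
    (hG : ∀ a b, dist a b < δ → dist (G a) (G b) < ε) {t : ℝ} (ht0 : t ≠ 0) (ht : |t| < δ)
    (x : ℝ) : |symQuot F x t - G x| ≤ 2 * ε := by
  obtain ⟨F₁, h1, h2⟩ := h
  have hs0 : 0 < |t| := abs_pos.2 ht0
  rw [symQuot, ← avg_abs, ← sq_abs]
  generalize |t| = s at ht hs0
  have d1 : ∀ r, HasDerivAt (fun r => F (x + r) + F (x - r) - 2 * F x - r ^ 2 * G x)
      (F₁ (x + r) - F₁ (x - r) - 2 * r * G x) r := by
    intro r
    have a := (h1 (x + r)).comp_const_add x r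
    have b := (h1 (x - r)).comp_const_sub x r
    have c := (hasDerivAt_pow 2 r).mul_const (G x)
    exact (((a.add b).sub_const (2 * F x)).sub c).congr_deriv (by push_cast; ring)
  have d2 : ∀ r, HasDerivAt (fun r => F₁ (x + r) - F₁ (x - r) - 2 * r * G x)
      (G (x + r) + G (x - r) - 2 * G x) r := by
    intro r
    have a := (h2 (x + r)).comp_const_add x r
    have b := (h2 (x - r)).comp_const_sub x r
    have c := ((hasDerivAt_id r).const_mul 2).mul_const (G x)
    exact ((a.sub b).sub c).congr_deriv (by ring)
  have b2 : ∀ r ∈ Set.Icc 0 s, |G (x + r) + G (x - r) - 2 * G x| ≤ 2 * ε := by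
    intro r hr
    have hr' : |r| < δ := by rw [abs_of_nonneg hr.1]; exact hr.2.trans_lt ht
    have u := hG (x + r) x (by simpa using hr')
    have v := hG (x - r) x (by simpa using hr')
    rw [Real.dist_eq, abs_lt] at u v
    rw [abs_le]
    constructor <;> linarith [u.1, u.2, v.1, v.2]
  have hε : 0 ≤ 2 * ε := (abs_nonneg _).trans (b2 0 (Set.left_mem_Icc.2 hs0.le))
  have b1 : ∀ r ∈ Set.Icc 0 s, |F₁ (x + r) - F₁ (x - r) - 2 * r * G x| ≤ 2 * ε * s := fun r hr =>
    (abs_le_of_hasDerivAt_le d2 (by simp) b2 hr).trans (mul_le_mul_of_nonneg_left hr.2 hε)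
  have b0 := abs_le_of_hasDerivAt_le d1 (by simp; ring) b1 (Set.right_mem_Icc.2 hs0.le)
  have e : 2 / s ^ 2 * (avg F s x - F x) - G x =
      (F (x + s) + F (x - s) - 2 * F x - s ^ 2 * G x) / s ^ 2 := by
    unfold avg
    field_simp
  rw [e, abs_div, abs_of_pos (by positivity : 0 < s ^ 2), div_le_iff₀ (by positivity)]
  linarith

theorem HasSecondDeriv.tendsto_symQuot {F G : ℝ → ℝ} (h : HasSecondDeriv F G)
    (hG : UniformContinuous G) (x : ℝ) :
    Filter.Tendsto (symQuot F x) (𝓝[≠] 0) (𝓝 (G x)) := by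
  rw [Metric.tendsto_nhdsWithin_nhds]
  intro ε hε
  obtain ⟨δ, hδ, h1⟩ := Metric.uniformContinuous_iff.1 hG (ε / 4) (by positivity)
  refine ⟨δ, hδ, fun t ht0 ht => ?_⟩
  rw [Real.dist_eq]
  refine (h.abs_symQuot_sub_le (fun a b h => h1 h) ht0 ?_ x).trans_lt (by linarith)
  simpa using ht

/-! ### Schwarz's theorem on second symmetric derivatives. -/

theorem symQuot_add (F G : ℝ → ℝ) (x t : ℝ) :
    symQuot (fun y => F y + G y) x t = symQuot F x t + symQuot G x t := by
  unfold symQuot avg; ring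

theorem symQuot_const_mul (c : ℝ) (F : ℝ → ℝ) (x t : ℝ) :
    symQuot (fun y => c * F y) x t = c * symQuot F x t := by
  unfold symQuot avg; ring

/-- Maximum principle: at an interior maximum the symmetric quotients are nonpositive for small t,
so their limit could not be m > 0. -/
theorem nonpos_of_tendsto_symQuot_pos {K : ℝ → ℝ} (hK : Continuous K) {a b m : ℝ} (hm : 0 < m)
    (ha : K a ≤ 0) (hb : K b ≤ 0)
    (h : ∀ x, Filter.Tendsto (symQuot K x) (𝓝[≠] 0) (𝓝 m)) {x : ℝ} (hx : x ∈ Set.Icc a b) :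
    K x ≤ 0 := by
  obtain ⟨z, hz, hmax⟩ := isCompact_Icc.exists_isMaxOn ⟨x, hx⟩ hK.continuousOn
  by_contra! hpos
  have hz0 : 0 < K z := hpos.trans_le (hmax hx)
  have hza : a < z := hz.1.lt_of_ne fun e => by subst e; linarith
  have hzb : z < b := hz.2.lt_of_ne fun e => by subst e; linarith
  have hle : m ≤ 0 := by
    refine le_of_tendsto (h z) ?_
    have hn : ∀ᶠ t in 𝓝 (0 : ℝ), |t| < min (z - a) (b - z) := by
      have : Filter.Tendsto (fun t : ℝ => |t|) (𝓝 0) (𝓝 0) := by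
        simpa using (continuous_abs (G := ℝ)).tendsto 0
      exact this.eventually (gt_mem_nhds (lt_min (by linarith) (by linarith)))
    filter_upwards [hn.filter_mono nhdsWithin_le_nhds] with t ht
    have h1 := abs_lt.1 (ht.trans_le (min_le_left _ _))
    have h2 := abs_lt.1 (ht.trans_le (min_le_right _ _))
    have u : K (z + t) ≤ K z := hmax ⟨by linarith, by linarith⟩
    have v : K (z - t) ≤ K z := hmax ⟨by linarith, by linarith⟩
    unfold symQuot avg
    exact mul_nonpos_of_nonneg_of_nonpos (by positivity) (by linarith)
  linarith

theorem symQuot_quadratic (a b x : ℝ) {t : ℝ} (ht : t ≠ 0) :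
    symQuot (fun y => (y - a) * (y - b)) x t = 2 := by
  unfold symQuot avg
  field_simp
  ring

theorem nonpos_of_tendsto_symQuot_zero {K : ℝ → ℝ} (hK : Continuous K) {a b : ℝ}
    (ha : K a = 0) (hb : K b = 0)
    (h : ∀ x, Filter.Tendsto (symQuot K x) (𝓝[≠] 0) (𝓝 0)) {x : ℝ} (hx : x ∈ Set.Icc a b) :
    K x ≤ 0 := by
  -- The perturbation vanishes at both endpoints and makes the second symmetric derivative equal to
  -- 2ε > 0; then ε tends to 0.
  have key : ∀ ε > 0, K x + ε * ((x - a) * (x - b)) ≤ 0 := by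
    intro ε hε
    refine nonpos_of_tendsto_symQuot_pos (K := fun y => K y + ε * ((y - a) * (y - b)))
      (by fun_prop) (by positivity : 0 < 0 + ε * 2) (by simp [ha]) (by simp [hb])
      (fun z => ?_) hx
    refine ((h z).add_const (ε * 2)).congr' ?_
    filter_upwards [self_mem_nhdsWithin] with t ht
    rw [symQuot_add, symQuot_const_mul, symQuot_quadratic a b z ht]
  have ht : Filter.Tendsto (fun ε : ℝ => K x + ε * ((x - a) * (x - b))) (𝓝[>] 0)
      (𝓝 (K x + 0 * ((x - a) * (x - b)))) :=
    ((Continuous.tendsto (by fun_prop) 0)).mono_left nhdsWithin_le_nhds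
  rw [zero_mul, add_zero] at ht
  exact le_of_tendsto ht (by filter_upwards [self_mem_nhdsWithin] with ε hε using key ε hε)

theorem symQuot_sub_affine (K : ℝ → ℝ) (a b x t : ℝ) :
    symQuot (fun y => K y - (a + b * y)) x t = symQuot K x t := by
  unfold symQuot avg; ring

theorem eq_zero_of_tendsto_symQuot_zero {K : ℝ → ℝ} (hK : Continuous K) {a b : ℝ}
    (ha : K a = 0) (hb : K b = 0)
    (h : ∀ x, Filter.Tendsto (symQuot K x) (𝓝[≠] 0) (𝓝 0)) {x : ℝ} (hx : x ∈ Set.Icc a b) :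
    K x = 0 := by
  refine le_antisymm (nonpos_of_tendsto_symQuot_zero hK ha hb h hx) ?_
  have := nonpos_of_tendsto_symQuot_zero (K := fun y => -1 * K y) (by fun_prop)
    (by simp [ha]) (by simp [hb]) (fun z => ?_) hx
  · linarith
  · have := (h z).const_mul (-1)
    rw [mul_zero] at this
    exact this.congr fun t => (symQuot_const_mul (-1) K z t).symm

/-- Schwarz's theorem: a continuous function with zero second symmetric derivative is affine. -/
theorem exists_affine_of_tendsto_symQuot_zero {K : ℝ → ℝ} (hK : Continuous K)
    (h : ∀ x, Filter.Tendsto (symQuot K x) (𝓝[≠] 0) (𝓝 0)) : ∃ a b : ℝ, ∀ x, K x = a + b * x := by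
  -- On [u, v] the function equals its chord. This is used for the points 0, 1 and x in each of
  -- their possible orders.
  have key : ∀ u v x : ℝ, u < v → x ∈ Set.Icc u v →
      K x * (v - u) = K u * (v - x) + K v * (x - u) := by
    intro u v x huv hx
    have hne : v - u ≠ 0 := (sub_pos.2 huv).ne'
    have := eq_zero_of_tendsto_symQuot_zero
      (K := fun y => K y - ((K u * v - K v * u) / (v - u) + (K v - K u) / (v - u) * y))
      (by fun_prop) (a := u) (b := v) (by field_simp; ring) (by field_simp; ring)
      (fun z => (h z).congr fun t => (symQuot_sub_affine K _ _ z t).symm) hx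
    field_simp at this
    linear_combination this
  refine ⟨K 0, K 1 - K 0, fun x => ?_⟩
  rcases lt_or_ge x 0 with h0 | h0
  · linear_combination -key x 1 0 (by linarith) ⟨h0.le, zero_le_one⟩
  rcases le_or_gt x 1 with h1 | h1
  · linear_combination key 0 1 x one_pos ⟨h0, h1⟩
  · linear_combination -key 0 x 1 (by linarith) ⟨zero_le_one, h1.le⟩

theorem exists_hasSecondDeriv {G : ℝ → ℝ} (hG : Continuous G) : ∃ F, HasSecondDeriv F G := by
  have h1 : ∀ x, HasDerivAt (fun x => ∫ y in (0 : ℝ)..x, G y) (G x) x := fun x =>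
    hG.integral_hasStrictDerivAt 0 x |>.hasDerivAt
  have hc : Continuous fun x => ∫ y in (0 : ℝ)..x, G y :=
    continuous_iff_continuousAt.2 fun x => (h1 x).continuousAt
  exact ⟨_, _, fun x => (hc.integral_hasStrictDerivAt 0 x).hasDerivAt, h1⟩

/-- A double primitive P of G has the same second symmetric derivative as F, so F - P is affine by
Schwarz's theorem. -/
theorem hasSecondDeriv_of_tendsto_symQuot {F G : ℝ → ℝ} (hF : Continuous F)
    (hG : UniformContinuous G) (h : ∀ x, Filter.Tendsto (symQuot F x) (𝓝[≠] 0) (𝓝 (G x))) :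
    HasSecondDeriv F G := by
  obtain ⟨P, hP⟩ := exists_hasSecondDeriv hG.continuous
  obtain ⟨P₁, h1, h2⟩ := id hP
  have hPc : Continuous P := continuous_iff_continuousAt.2 fun x => (h1 x).continuousAt
  obtain ⟨a, b, hab⟩ := exists_affine_of_tendsto_symQuot_zero (K := fun x => F x + -1 * P x)
    (by fun_prop) fun x => by
      have := (h x).add ((hP.tendsto_symQuot hG x).const_mul (-1))
      rw [show G x + -1 * G x = 0 by ring] at this
      exact this.congr fun t => by rw [symQuot_add, symQuot_const_mul]
  have e : F = fun x => P x + (a + b * x) := funext fun x => by linear_combination hab x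
  refine ⟨fun x => P₁ x + b, fun x => ?_, fun x => (h2 x).add_const b⟩
  rw [e]
  exact ((h1 x).add (((hasDerivAt_id x).const_mul b).const_add a)).congr_deriv (by rw [mul_one])

/-! ### The generator -/

theorem mem_domain_iff {p q : ℝ} (hpq : p + q ≠ 0) (f g : CLim) :
    (∃ hf : f ∈ (deltaStar p q).domain, deltaStar p q ⟨f, hf⟩ = g) ↔
      HasSecondDeriv (extL (skew p q) f.1) (extL (skew p q) g.1) ∧
        HasSecondDeriv (extR (skew p q) f.1) (extR (skew p q) g.1) := by
  constructor
  · rintro ⟨hf, rfl⟩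
    exact ⟨IsInDomain.hasSecondDeriv_extL hpq hf, IsInDomain.hasSecondDeriv_extR hpq hf⟩
  · rintro ⟨hL, hR⟩
    obtain ⟨hf, e⟩ := isInDomain_of_hasSecondDeriv hpq g.1.continuous g.2 hL hR
    exact ⟨hf, CLim.ext fun x => congrFun e x⟩

theorem evalL_quotient (p q t : ℝ) (f : CLim) (x : ℝ) :
    evalL (skew p q) x ((2 / t ^ 2) • (cosStar p q t f - f)) =
      symQuot (extL (skew p q) f.1) x t := by
  rw [map_smul, map_sub, evalL_apply, evalL_apply, extL_cosStar]
  rfl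

theorem evalR_quotient (p q t : ℝ) (f : CLim) (x : ℝ) :
    evalR (skew p q) x ((2 / t ^ 2) • (cosStar p q t f - f)) =
      symQuot (extR (skew p q) f.1) x t := by
  rw [map_smul, map_sub, evalR_apply, evalR_apply, extR_cosStar]
  rfl

theorem isInfinitesimalGenerator_deltaStar {p q : ℝ} (hpq : p + q ≠ 0) :
    IsInfinitesimalGenerator (cosStar p q) (deltaStar p q) := by
  intro f g
  rw [mem_domain_iff hpq]
  constructor
  · rintro ⟨hL, hR⟩
    rw [Metric.tendsto_nhdsWithin_nhds]
    intro ε hε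
    obtain ⟨δ, hδ, h1⟩ := Metric.uniformContinuous_iff.1 (uniformContinuous_extL (skew p q) g)
      (ε / 4) (by positivity)
    obtain ⟨δ', hδ', h2⟩ := Metric.uniformContinuous_iff.1 (uniformContinuous_extR (skew p q) g)
      (ε / 4) (by positivity)
    refine ⟨min δ δ', lt_min hδ hδ', fun t ht0 ht => ?_⟩
    rw [dist_zero_right, Real.norm_eq_abs] at ht
    rw [dist_eq_norm]
    refine (norm_le_of_ext (skew p q) (by positivity : 0 ≤ 2 * (ε / 4)) (fun x _ => ?_)
      fun x _ => ?_).trans_lt (by linarith)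
    · rw [← evalL_apply, map_sub, evalL_quotient, evalL_apply]
      exact hL.abs_symQuot_sub_le (fun a b h => h1 h) ht0 (ht.trans_le (min_le_left _ _)) x
    · rw [← evalR_apply, map_sub, evalR_quotient, evalR_apply]
      exact hR.abs_symQuot_sub_le (fun a b h => h2 h) ht0 (ht.trans_le (min_le_right _ _)) x
  · intro h
    refine ⟨hasSecondDeriv_of_tendsto_symQuot (uniformContinuous_extL _ f).continuous
        (uniformContinuous_extL _ g) fun x => ?_,
      hasSecondDeriv_of_tendsto_symQuot (uniformContinuous_extR _ f).continuous
        (uniformContinuous_extR _ g) fun x => ?_⟩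
    · rw [← evalL_apply]
      exact (((evalL (skew p q) x).continuous.tendsto g).comp h).congr fun t =>
        evalL_quotient p q t f x
    · rw [← evalR_apply]
      exact (((evalR (skew p q) x).continuous.tendsto g).comp h).congr fun t =>
        evalR_quotient p q t f x

open MeasureTheory

/-! ### Laplace transforms of bounded functions -/

theorem integrableOn_exp_smul {E : Type*} [NormedAddCommGroup E] [NormedSpace ℝ E] {l : ℝ}
    (hl : 0 < l) {u : ℝ → E} (hu : Continuous u) {M : ℝ} (hM : ∀ t, ‖u t‖ ≤ M) :
    IntegrableOn (fun t : ℝ => Real.exp (-l * t) • u t) (Set.Ioi 0) := by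
  refine ((integrableOn_exp_mul_Ioi (neg_lt_zero.2 hl) 0).mul_const M).mono'
    (Continuous.aestronglyMeasurable (by fun_prop)) (.of_forall fun t => ?_)
  rw [norm_smul, Real.norm_eq_abs, Real.abs_exp]
  exact mul_le_mul_of_nonneg_left (hM t) (Real.exp_pos _).le

theorem norm_integral_exp_smul_le {E : Type*} [NormedAddCommGroup E] [NormedSpace ℝ E] {l : ℝ}
    (hl : 0 < l) {u : ℝ → E} {M : ℝ} (hM : ∀ t, ‖u t‖ ≤ M) :
    ‖∫ t in Set.Ioi (0 : ℝ), Real.exp (-l * t) • u t‖ ≤ l⁻¹ * M := by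
  have h := norm_integral_le_of_norm_le (f := fun t : ℝ => Real.exp (-l * t) • u t)
    ((integrableOn_exp_mul_Ioi (neg_lt_zero.2 hl) 0).mul_const M) (.of_forall fun t => by
      rw [norm_smul, Real.norm_eq_abs, Real.abs_exp]
      exact mul_le_mul_of_nonneg_left (hM t) (Real.exp_pos _).le)
  rwa [integral_mul_const, integral_exp_mul_Ioi (neg_lt_zero.2 hl), mul_zero, Real.exp_zero,
    neg_div_neg_eq, one_div] at h

/-- The one-sided exponential potential of `G`. -/
def expPot (l : ℝ) (G : ℝ → ℝ) (x : ℝ) : ℝ :=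
  ∫ t in Set.Ioi (0 : ℝ), Real.exp (-l * t) * G (x + t)

theorem hasDerivAt_expPot {l : ℝ} (hl : 0 < l) {G : ℝ → ℝ} (hG : Continuous G) {M : ℝ}
    (hM : ∀ x, |G x| ≤ M) (x : ℝ) : HasDerivAt (expPot l G) (l * expPot l G x - G x) x := by
  set k : ℝ → ℝ := fun y => Real.exp (-l * y) * G y with hk
  have hkc : Continuous k := by fun_prop
  have hki : ∀ a, IntegrableOn k (Set.Ioi a) := fun a =>
    ((integrableOn_exp_mul_Ioi (neg_lt_zero.2 hl) a).mul_const M).mono'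
      hkc.aestronglyMeasurable (.of_forall fun t => by
        rw [hk, Real.norm_eq_abs, abs_mul, Real.abs_exp]
        exact mul_le_mul_of_nonneg_left (hM t) (Real.exp_pos _).le)
  -- The substitution y = z + t turns the potential into exp(lz) times the integral of k over (z,
  -- ∞). Writing that tail as a constant minus an integral from 0 to z exposes it to the fundamental
  -- theorem of calculus.
  have e : ∀ z, expPot l G z =
      Real.exp (l * z) * ((∫ y in Set.Ioi 0, k y) - ∫ y in (0 : ℝ)..z, k y) := by
    intro z
    rw [← intervalIntegral.integral_interval_add_Ioi (hki 0) (hki z), add_sub_cancel_left,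
      ← (measurePreserving_add_right volume z).setIntegral_preimage_emb
        (measurableEmbedding_addRight z), Set.preimage_add_const_Ioi, sub_self,
      ← integral_const_mul]
    refine integral_congr_ae (.of_forall fun t => ?_)
    simp only [hk]
    rw [← mul_assoc, ← Real.exp_add, add_comm t z]
    congr 2
    ring
  rw [funext e]
  have h1 : HasDerivAt (fun z : ℝ => Real.exp (l * z)) (Real.exp (l * x) * l) x := by
    simpa using ((hasDerivAt_id x).const_mul l).exp
  have h2 := ((hkc.integral_hasStrictDerivAt 0 x).hasDerivAt).const_sub (∫ y in Set.Ioi 0, k y)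
  refine (h1.mul h2).congr_deriv ?_
  have h3 : Real.exp (l * x) * Real.exp (-l * x) = 1 := by
    rw [← Real.exp_add, neg_mul, add_neg_cancel, Real.exp_zero]
  simp only [hk]
  linear_combination -(G x) * h3

/-- F is (P + Q)/(2l), where P and Q are the forward and backward exponential potentials of G, with
P' = lP - G and Q' = G - lQ. In F' = (P - Q)/2 the terms in G cancel, and a second differentiation
gives l²F - G. -/
theorem hasSecondDeriv_laplace {l : ℝ} (hl : 0 < l) {G : ℝ → ℝ} (hG : Continuous G) {M : ℝ}
    (hM : ∀ x, |G x| ≤ M) {F : ℝ → ℝ}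
    (hF : ∀ x, l * F x = ∫ t in Set.Ioi (0 : ℝ), Real.exp (-l * t) * avg G t x) :
    HasSecondDeriv F fun x => l ^ 2 * F x - G x := by
  set H : ℝ → ℝ := fun y => G (-y)
  have hHc : Continuous H := by fun_prop
  have hP := hasDerivAt_expPot hl hG hM
  have hQ : ∀ x, HasDerivAt (fun x => expPot l H (-x)) (-(l * expPot l H (-x) - G x)) x := fun x => by
    have := hasDerivAt_comp_neg (hasDerivAt_expPot hl hHc (fun y => hM (-y)) (-x))
    simpa [H] using this
  have e : F = fun x => (expPot l G x + expPot l H (-x)) / (2 * l) := by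
    funext x
    have i1 : IntegrableOn (fun t : ℝ => Real.exp (-l * t) * G (x + t)) (Set.Ioi 0) :=
      integrableOn_exp_smul hl (u := fun t => G (x + t)) (by fun_prop) fun t => hM _
    have i2 : IntegrableOn (fun t : ℝ => Real.exp (-l * t) * H (-x + t)) (Set.Ioi 0) :=
      integrableOn_exp_smul hl (u := fun t => H (-x + t)) (by fun_prop) fun t => hM _
    rw [eq_div_iff (by positivity), mul_comm 2 l, ← mul_assoc, mul_comm (F x), hF, expPot, expPot,
      ← integral_add i1 i2, ← integral_mul_const]
    refine integral_congr_ae (.of_forall fun t => ?_)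
    simp only [avg, H, neg_add, neg_neg, ← sub_eq_add_neg]
    ring
  refine ⟨fun x => (expPot l G x - expPot l H (-x)) / 2, fun x => ?_, fun x => ?_⟩
  · rw [e]
    exact (((hP x).add (hQ x)).div_const (2 * l)).congr_deriv (by field_simp; ring)
  · rw [e]
    exact (((hP x).sub (hQ x)).div_const 2).congr_deriv (by field_simp; ring)

/-- Somewhere in (x, x + 1) the derivative equals F(x + 1) - F(x), and from there to x it changes by
at most N. This bound makes the boundary term at infinity vanish in the Laplace integral. -/
theorem HasSecondDeriv.abs_deriv_le {F F₁ G : ℝ → ℝ} (h1 : ∀ x, HasDerivAt F (F₁ x) x)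
    (h2 : ∀ x, HasDerivAt F₁ (G x) x) {M N : ℝ} (hF : ∀ x, |F x| ≤ M) (hG : ∀ x, |G x| ≤ N)
    (x : ℝ) : |F₁ x| ≤ 2 * M + N := by
  obtain ⟨c, hc, e⟩ := exists_hasDerivAt_eq_slope F F₁ (by linarith : x < x + 1)
    (fun y _ => (h1 y).continuousAt.continuousWithinAt) fun y _ => h1 y
  obtain ⟨d, -, e'⟩ := exists_hasDerivAt_eq_slope F₁ G hc.1
    (fun y _ => (h2 y).continuousAt.continuousWithinAt) fun y _ => h2 y
  rw [add_sub_cancel_left, div_one] at e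
  rw [eq_div_iff (sub_pos.2 hc.1).ne'] at e'
  have a := abs_le.1 (hF (x + 1))
  have b := abs_le.1 (hF x)
  have hN : |F₁ c - F₁ x| ≤ N := by
    rw [← e', abs_mul, abs_of_pos (sub_pos.2 hc.1)]
    have := hG d
    have := abs_nonneg (G d)
    nlinarith [hc.2]
  have := abs_le.1 hN
  rw [abs_le]
  constructor <;> linarith [this.1, this.2, a.1, a.2, b.1, b.2]

theorem HasSecondDeriv.integral_laplace {F G : ℝ → ℝ} (h : HasSecondDeriv F G)
    (hGc : Continuous G) {M N : ℝ} (hF : ∀ x, |F x| ≤ M) (hG : ∀ x, |G x| ≤ N) {l : ℝ} (hl : 0 < l)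
    (x : ℝ) : ∫ t in Set.Ioi (0 : ℝ), Real.exp (-l * t) * avg (fun y => l ^ 2 * F y - G y) t x =
      l * F x := by
  obtain ⟨F₁, h1, h2⟩ := h
  have hFc : Continuous F := continuous_iff_continuousAt.2 fun x => (h1 x).continuousAt
  have hb := HasSecondDeriv.abs_deriv_le h1 h2 hF hG
  -- The second summand of w is the t-derivative of the average, so -exp(-lt) w(t) is a primitive of
  -- the integrand. It equals -l F(x) at t = 0 and tends to 0 at infinity.
  set w : ℝ → ℝ := fun t => l * avg F t x + (F₁ (x + t) - F₁ (x - t)) / 2 with hw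
  have hd : ∀ t, HasDerivAt (fun t => -(Real.exp (-l * t) * w t))
      (Real.exp (-l * t) * avg (fun y => l ^ 2 * F y - G y) t x) t := by
    intro t
    have he : HasDerivAt (fun z : ℝ => Real.exp (-l * z)) (Real.exp (-l * t) * -l) t := by
      simpa using ((hasDerivAt_id t).const_mul (-l)).exp
    have ha := (((h1 (x + t)).comp_const_add x t).add ((h1 (x - t)).comp_const_sub x t)).div_const 2
    have hb := (((h2 (x + t)).comp_const_add x t).sub ((h2 (x - t)).comp_const_sub x t)).div_const 2
    refine (he.mul ((ha.const_mul l).add hb)).neg.congr_deriv ?_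
    simp only [avg, Pi.add_apply, Pi.sub_apply]
    ring
  have hint : IntegrableOn (fun t : ℝ => Real.exp (-l * t) *
      avg (fun y => l ^ 2 * F y - G y) t x) (Set.Ioi 0) := by
    refine integrableOn_exp_smul hl (u := fun t => avg (fun y => l ^ 2 * F y - G y) t x)
      (by unfold avg; fun_prop) (M := l ^ 2 * M + N) fun t => ?_
    have key : ∀ y, |l ^ 2 * F y - G y| ≤ l ^ 2 * M + N := fun y => by
      refine (abs_sub _ _).trans (add_le_add ?_ (hG y))
      rw [abs_mul, abs_of_nonneg (sq_nonneg l)]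
      exact mul_le_mul_of_nonneg_left (hF y) (sq_nonneg l)
    have a := abs_le.1 (key (x + t))
    have b := abs_le.1 (key (x - t))
    rw [Real.norm_eq_abs, avg, abs_le]
    constructor <;> linarith [a.1, a.2, b.1, b.2]
  have hlim : Filter.Tendsto (fun t => -(Real.exp (-l * t) * w t)) Filter.atTop (𝓝 0) := by
    have he : Filter.Tendsto (fun t : ℝ => Real.exp (-l * t)) Filter.atTop (𝓝 0) :=
      Real.tendsto_exp_atBot.comp (Filter.tendsto_id.const_mul_atTop_of_neg (neg_lt_zero.2 hl))
    have hwb : ∀ t, |w t| ≤ l * M + (2 * M + N) := fun t => by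
      have a := abs_le.1 (hF (x + t))
      have b := abs_le.1 (hF (x - t))
      have c := abs_le.1 (hb (x + t))
      have d := abs_le.1 (hb (x - t))
      have e : |avg F t x| ≤ M := by
        rw [avg, abs_le]; constructor <;> linarith [a.1, a.2, b.1, b.2]
      refine (abs_add_le _ _).trans (add_le_add ?_ ?_)
      · rw [abs_mul, abs_of_pos hl]
        exact mul_le_mul_of_nonneg_left e hl.le
      · rw [abs_le]; constructor <;> linarith [c.1, c.2, d.1, d.2]
    have := (he.zero_mul_isBoundedUnder_le (g := w)
      ⟨l * M + (2 * M + N), Filter.eventually_map.2 (.of_forall hwb)⟩).neg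
    rwa [neg_zero] at this
  rw [integral_Ioi_of_hasDerivAt_of_tendsto' (fun t _ => hd t) hint hlim]
  simp [hw, avg]

/-! ### The resolvent -/

theorem norm_cosStar_apply_le {p q : ℝ} (hp : 0 ≤ p) (hq : 0 ≤ q) (hpq : 0 < p + q) (t : ℝ)
    (g : CLim) : ‖cosStar p q t g‖ ≤ 2 * max p q / (p + q) * ‖g‖ :=
  (cosStar p q t).le_of_opNorm_le (norm_cosStar_le hp hq hpq t) g

theorem integrableOn_cosStar {p q : ℝ} (hp : 0 ≤ p) (hq : 0 ≤ q) (hpq : 0 < p + q) {l : ℝ}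
    (hl : 0 < l) (g : CLim) :
    IntegrableOn (fun t : ℝ => Real.exp (-l * t) • cosStar p q t g) (Set.Ioi 0) :=
  integrableOn_exp_smul hl (continuous_cosStar p q g) fun t => norm_cosStar_apply_le hp hq hpq t g

/-- The resolvent of `Δ*_{p,q}` at `l²`, as a Laplace transform. -/
def laplaceResolvent {p q : ℝ} (hp : 0 ≤ p) (hq : 0 ≤ q) (hpq : 0 < p + q) {l : ℝ} (hl : 0 < l) :
    CLim →L[ℝ] CLim :=
  LinearMap.mkContinuous
    { toFun := fun g => l⁻¹ • ∫ t in Set.Ioi (0 : ℝ), Real.exp (-l * t) • cosStar p q t g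
      map_add' := fun f g => by
        simp only [map_add, smul_add]
        rw [integral_add (integrableOn_cosStar hp hq hpq hl f)
          (integrableOn_cosStar hp hq hpq hl g), smul_add]
      map_smul' := fun c g => by
        simp only [map_smul, smul_comm _ c, integral_smul, RingHom.id_apply] }
    (l⁻¹ * (l⁻¹ * (2 * max p q / (p + q)))) fun g => by
      change ‖l⁻¹ • ∫ t in Set.Ioi (0 : ℝ), Real.exp (-l * t) • cosStar p q t g‖ ≤ _
      rw [norm_smul, Real.norm_of_nonneg (inv_pos.2 hl).le, mul_assoc, mul_assoc]
      exact mul_le_mul_of_nonneg_left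
        (norm_integral_exp_smul_le hl fun t => norm_cosStar_apply_le hp hq hpq t g)
        (inv_pos.2 hl).le

section Resolvent

variable {p q : ℝ} (hp : 0 ≤ p) (hq : 0 ≤ q) (hpq : 0 < p + q) {l : ℝ} (hl : 0 < l)

theorem smul_laplaceResolvent (g : CLim) : l • laplaceResolvent hp hq hpq hl g =
    ∫ t in Set.Ioi (0 : ℝ), Real.exp (-l * t) • cosStar p q t g := by
  change l • (l⁻¹ • ∫ t in Set.Ioi (0 : ℝ), Real.exp (-l * t) • cosStar p q t g) = _
  rw [smul_smul, mul_inv_cancel₀ hl.ne', one_smul]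

/-- A bounded functional passes through the Bochner integral, so the resolvent is described
pointwise by scalar Laplace transforms of averages. -/
theorem extL_laplaceResolvent (g : CLim) (x : ℝ) :
    l * extL (skew p q) (laplaceResolvent hp hq hpq hl g).1 x =
      ∫ t in Set.Ioi (0 : ℝ), Real.exp (-l * t) * avg (extL (skew p q) g.1) t x := by
  rw [← evalL_apply, ← smul_eq_mul, ← map_smul, smul_laplaceResolvent,
    ← ContinuousLinearMap.integral_comp_comm _ (integrableOn_cosStar hp hq hpq hl g)]
  simp only [map_smul, evalL_apply, extL_cosStar, smul_eq_mul]

theorem extR_laplaceResolvent (g : CLim) (x : ℝ) :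
    l * extR (skew p q) (laplaceResolvent hp hq hpq hl g).1 x =
      ∫ t in Set.Ioi (0 : ℝ), Real.exp (-l * t) * avg (extR (skew p q) g.1) t x := by
  rw [← evalR_apply, ← smul_eq_mul, ← map_smul, smul_laplaceResolvent,
    ← ContinuousLinearMap.integral_comp_comm _ (integrableOn_cosStar hp hq hpq hl g)]
  simp only [map_smul, evalR_apply, extR_cosStar, smul_eq_mul]

theorem extL_smul_sub (c a : ℝ) (f g : CLim) (x : ℝ) :
    extL c (a • f - g).1 x = a * extL c f.1 x - extL c g.1 x := by
  simp only [← evalL_apply, map_sub, map_smul, smul_eq_mul]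

theorem extR_smul_sub (c a : ℝ) (f g : CLim) (x : ℝ) :
    extR c (a • f - g).1 x = a * extR c f.1 x - extR c g.1 x := by
  simp only [← evalR_apply, map_sub, map_smul, smul_eq_mul]

theorem deltaStar_laplaceResolvent (g : CLim) :
    ∃ hf : laplaceResolvent hp hq hpq hl g ∈ (deltaStar p q).domain,
      deltaStar p q ⟨_, hf⟩ = l ^ 2 • laplaceResolvent hp hq hpq hl g - g := by
  have hg : ∀ x, |g.1 x| ≤ ‖g‖ := fun x => g.1.norm_coe_le_norm x
  refine (mem_domain_iff hpq.ne' _ _).2 ⟨?_, ?_⟩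
  · rw [funext (extL_smul_sub _ _ _ _)]
    exact hasSecondDeriv_laplace hl (continuous_extL _ g.1.continuous) (abs_extL_le hg)
      (extL_laplaceResolvent hp hq hpq hl g)
  · rw [funext (extR_smul_sub _ _ _ _)]
    exact hasSecondDeriv_laplace hl (continuous_extR _ g.1.continuous) (abs_extR_le hg)
      (extR_laplaceResolvent hp hq hpq hl g)

theorem laplaceResolvent_deltaStar (f : (deltaStar p q).domain) :
    laplaceResolvent hp hq hpq hl (l ^ 2 • (f : CLim) - deltaStar p q f) = f := by
  obtain ⟨hL, hR⟩ := (mem_domain_iff hpq.ne' (f : CLim) (deltaStar p q f)).1 ⟨f.2, rfl⟩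
  generalize deltaStar p q f = g at hL hR
  have hf : ∀ x, |(f : CLim).1 x| ≤ ‖(f : CLim)‖ := fun x => (f : CLim).1.norm_coe_le_norm x
  have hg : ∀ x, |g.1 x| ≤ ‖g‖ := fun x => g.1.norm_coe_le_norm x
  refine eq_of_ext (skew p q) (fun x => mul_left_cancel₀ hl.ne' ?_)
    fun x => mul_left_cancel₀ hl.ne' ?_
  · rw [extL_laplaceResolvent, funext (extL_smul_sub _ _ _ _)]
    exact hL.integral_laplace (continuous_extL _ g.1.continuous) (abs_extL_le hf) (abs_extL_le hg)
      hl x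
  · rw [extR_laplaceResolvent, funext (extR_smul_sub _ _ _ _)]
    exact hR.integral_laplace (continuous_extR _ g.1.continuous) (abs_extR_le hf) (abs_extR_le hg)
      hl x

end Resolvent

theorem isLaplaceGenerator_deltaStar {p q : ℝ} (hp : 0 ≤ p) (hq : 0 ≤ q) (hpq : 0 < p + q) :
    IsLaplaceGenerator (cosStar p q) (deltaStar p q) := by
  intro l hl
  refine ⟨laplaceResolvent hp hq hpq hl,
    ⟨fun g => (deltaStar_laplaceResolvent hp hq hpq hl g).1, fun g => ?_,
      laplaceResolvent_deltaStar hp hq hpq hl⟩,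
    fun g => ⟨integrableOn_cosStar hp hq hpq hl g, smul_laplaceResolvent hp hq hpq hl g⟩⟩
  rw [(deltaStar_laplaceResolvent hp hq hpq hl g).2, sub_sub_cancel]

end SkewCosine

end

theorem theorem3 (p q : ℝ) (hp : 0 ≤ p) (hq : 0 ≤ q) (hpq : 0 < p + q) :
    SkewCosine.IsStronglyContinuousCosineFamily (SkewCosine.cosStar p q) ∧
    SkewCosine.IsInfinitesimalGenerator (SkewCosine.cosStar p q) (SkewCosine.deltaStar p q) ∧
    SkewCosine.IsLaplaceGenerator (SkewCosine.cosStar p q) (SkewCosine.deltaStar p q) ∧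
    ∀ t : ℝ, ‖SkewCosine.cosStar p q t‖ ≤ 2 * max p q / (p + q) :=
  ⟨SkewCosine.isStronglyContinuousCosineFamily_cosStar p q,
    SkewCosine.isInfinitesimalGenerator_deltaStar hpq.ne',
    SkewCosine.isLaplaceGenerator_deltaStar hp hq hpq,
    SkewCosine.norm_cosStar_le hp hq hpq⟩
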